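/- Let $A=(A_{ij})_{i,j\ge 0}$ be the infinite real matrix with $$A_{00}=\tfrac12,\quad A_{01}=-1,\quad A_{0j}=0\ (j\ge 2),$$ $$A_{10}=\frac{\pi^2}{12}+\sum_{k\ge1}\frac{(-1)^k}{k^22^k}-\frac{\log 2}{2},\quad A_{11}=\tfrac12+\log 2,\quad A_{1,k+1}=\frac1k+\frac{(-1)^k}{2^{k+1}}-\frac1{k2^k}\ (k\ge1),$$ and, for $r,k\ge 1$, $$A_{r+1,0}=\frac{(-1)^r}{r}\sum_{j\ge r}\frac1{j3^j},\quad A_{r+1,1}=0,\quad A_{r+1,k+1}=\binom kr\Big(\frac{(-1)^{k-r}}{2^{k+1}}-\frac1{k2^k}\Big),$$ where $\binom kr=0$ for $k<r$. It defines a bounded operator on real $\ell^1$ (column vectors). Let $A_m$ be its leading $(m+1)\times(m+1)$ block. For every $m\ge 7$ there is exactly one triple $(\lambda_m,v_m,w_m)$ such that $\lambda_m$ is a real eigenvalue of $A_m$ strictly larger in modulus than all its other complex eigenvalues, and $A_mv_m=\lambda_mv_m$, $w_mA_m=\lambda_mw_m$ with $(v_m)_0=(w_m)_0=1$. After padding by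 zeros, the limits $\lambda=\lim\lambda_m$, $v=\lim v_m$ (in $\ell^1$) and $w=\lim w_m$ (in $\ell^\infty$) exist. Moreover $\lambda>0$, $Av=\lambda v$, $wA=\lambda w$, every complex eigenvalue $z\neq\lambda$ of $A$ with an eigenvector in complex $\ell^1$ satisfies $|z|<\lambda$, and $\zeta:=wv=\sum_i w_iv_i\neq0$. If $u\in\ell^1$ satisfies $wu=\sum_i w_iu_i\ne 0$, then, in the $\ell^1$ norm, $$\lim_{n\to\infty}\lambda^{-n}A^nu=\frac{(wu)\,v}{\zeta}\qquad\text{and}\qquad \lim_{n\to\infty}\frac{A^nu}{\|A^nu\|}=\frac{(wu)\,v}{\|(wu)\,v\|}.$$ -/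

import Mathlib

open Filter Topology
open scoped ENNReal

noncomputable section

/-- The Banach space of real sequences `(ℓ, a₀, a₁, …)` with the `ℓ¹` norm (column vectors). -/
abbrev EllOne : Type := lp (fun _ : ℕ => ℝ) 1

/-- The Banach space of bounded real sequences with the sup norm (row vectors). -/
abbrev EllInf : Type := lp (fun _ : ℕ => ℝ) ∞

/-- The infinite matrix of the parking transform acting on the coefficients `(ℓ, a₀, a₁, …)` of
`ℓ log t + ∑ aₖ (t - 1)ᵏ`. Index `0` stands for `ℓ` and index `k + 1` for `aₖ`.
In the last clause the row is the one of `a_{r+1}` and the column the one of `a_{k+1}`; the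
exponent `k + r` has the parity of `k - r`, and the binomial coefficient vanishes for `k < r`. -/
def parkMatrix : ℕ → ℕ → ℝ
  | 0, 0 => 1 / 2
  | 0, 1 => -1
  | 0, _ + 2 => 0
  | 1, 0 => Real.pi ^ 2 / 12
      + (∑' k : ℕ, (-1 : ℝ) ^ (k + 1) / (((k : ℝ) + 1) ^ 2 * 2 ^ (k + 1))) - Real.log 2 / 2
  | 1, 1 => 1 / 2 + Real.log 2
  | 1, k + 2 => 1 / ((k : ℝ) + 1) + (-1 : ℝ) ^ (k + 1) / 2 ^ (k + 2)
      - 1 / (((k : ℝ) + 1) * 2 ^ (k + 1))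
  | r + 2, 0 => (-1 : ℝ) ^ (r + 1) / ((r : ℝ) + 1)
      * ∑' j : ℕ, 1 / (((j : ℝ) + r + 1) * 3 ^ (j + r + 1))
  | _ + 2, 1 => 0
  | r + 2, k + 2 => ((k + 1).choose (r + 1) : ℝ)
      * ((-1 : ℝ) ^ (k + r) / 2 ^ (k + 2) - 1 / (((k : ℝ) + 1) * 2 ^ (k + 1)))

/-- The leading `(m + 1) × (m + 1)` block. -/
def parkBlock (m : ℕ) : Matrix (Fin (m + 1)) (Fin (m + 1)) ℝ :=
  Matrix.of fun i j => parkMatrix i j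

/-- `μ` is the eigenvalue of maximum modulus of the block of size `m + 1`, every other complex
eigenvalue being strictly smaller in modulus, and `v`, `w` are the right and left eigenvectors
for `μ` whose entries of index `0` are equal to `1`. -/
structure IsPrincipalTriple (m : ℕ) (μ : ℝ) (v w : Fin (m + 1) → ℝ) : Prop where
  right_eigen : (parkBlock m).mulVec v = μ • v
  left_eigen : Matrix.vecMul w (parkBlock m) = μ • w
  right_zero : v 0 = 1
  left_zero : w 0 = 1
  dominant : ∀ z : ℂ, z ∈ spectrum ℂ ((parkBlock m).map (algebraMap ℝ ℂ)) →
    z ≠ (μ : ℂ) → ‖z‖ < |μ|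

/-- A finite vector, padded by zeros to an element of `ℓᵖ`. -/
def padZero (p : ℝ≥0∞) {m : ℕ} (x : Fin (m + 1) → ℝ) : lp (fun _ : ℕ => ℝ) p :=
  ∑ i : Fin (m + 1), lp.single p (i : ℕ) (x i)

/-- The product `w u` of a bounded row vector and a summable column vector. -/
def rowMul (w : EllInf) (u : EllOne) : ℝ := ∑' i : ℕ, w i * u i

theorem ellOne_summable (u : EllOne) : Summable fun j => |u j| := by
  have h := lp.memℓp u
  simpa using (memℓp_gen_iff (p := 1) (by simp)).1 h

theorem ellOne_norm (u : EllOne) : ‖u‖ = ∑' j, |u j| := by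
  simpa using lp.norm_eq_tsum_rpow (p := 1) (by simp) u

theorem ellOne_mk_norm {f : ℕ → ℝ} (h : Memℓp f 1) :
    ‖(⟨f, h⟩ : EllOne)‖ = ∑' j, |f j| := ellOne_norm _

theorem abs_tail_le (r : ℕ) :
    |(-1 : ℝ) ^ (r + 1) / ((r : ℝ) + 1)
      * ∑' j : ℕ, 1 / (((j : ℝ) + r + 1) * 3 ^ (j + r + 1))| ≤ 2 * (1 / 3 : ℝ) ^ r := by
  have hterm : ∀ j : ℕ, 1 / (((j : ℝ) + r + 1) * 3 ^ (j + r + 1)) ≤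
      (1 / 3 : ℝ) ^ r * (1 / 3 : ℝ) ^ j := by
    intro j
    rw [← pow_add, one_div_pow]
    apply one_div_le_one_div_of_le (by positivity)
    have h1 : (1 : ℝ) ≤ (j : ℝ) + r + 1 := by
      have : (0 : ℝ) ≤ (j : ℝ) + r := by positivity
      linarith
    have h2 : (3 : ℝ) ^ (r + j) ≤ 3 ^ (j + r + 1) :=
      pow_le_pow_right₀ (by norm_num) (by omega)
    calc (3 : ℝ) ^ (r + j) ≤ 1 * 3 ^ (j + r + 1) := by simpa using h2
      _ ≤ _ := by gcongr
  have hg : HasSum (fun j : ℕ => (1 / 3 : ℝ) ^ r * (1 / 3 : ℝ) ^ j)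
      ((1 / 3 : ℝ) ^ r * (1 - 1 / 3)⁻¹) :=
    (hasSum_geometric_of_lt_one (by norm_num) (by norm_num)).mul_left _
  have hs : Summable fun j : ℕ => 1 / (((j : ℝ) + r + 1) * 3 ^ (j + r + 1)) :=
    Summable.of_nonneg_of_le (fun j => by positivity) hterm hg.summable
  have ht := hs.tsum_le_tsum hterm hg.summable
  rw [hg.tsum_eq] at ht
  have h0 : 0 ≤ ∑' j : ℕ, 1 / (((j : ℝ) + r + 1) * 3 ^ (j + r + 1)) :=
    tsum_nonneg fun j => by positivity
  rw [abs_mul, abs_div, abs_pow, abs_neg, abs_one, one_pow, abs_of_nonneg h0,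
    abs_of_pos (by positivity : (0 : ℝ) < (r : ℝ) + 1)]
  have hr : 1 / ((r : ℝ) + 1) ≤ 1 := by
    rw [div_le_one (by positivity)]
    have : (0 : ℝ) ≤ r := by positivity
    linarith
  have hp : (0 : ℝ) ≤ (1 / 3) ^ r := by positivity
  calc _ ≤ 1 * ∑' j : ℕ, 1 / (((j : ℝ) + r + 1) * 3 ^ (j + r + 1)) := by gcongr
    _ ≤ _ := by linarith

theorem summable_parkMatrix_col (j : ℕ) : Summable fun i => |parkMatrix i j| := by
  match j with
  | 0 =>
    rw [← summable_nat_add_iff 2]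
    exact Summable.of_nonneg_of_le (fun _ => abs_nonneg _) abs_tail_le
      ((summable_geometric_of_lt_one (by norm_num) (by norm_num)).mul_left 2)
  | 1 =>
    rw [← summable_nat_add_iff 2]
    simp [parkMatrix]
  | k + 2 =>
    refine summable_of_ne_finset_zero (s := Finset.range (k + 3)) fun i hi => ?_
    obtain ⟨r, rfl⟩ : ∃ r, i = r + 2 := ⟨i - 2, by simp at hi; omega⟩
    simp at hi
    have : (k + 1).choose (r + 1) = 0 := Nat.choose_eq_zero_of_lt (by omega)
    simp [parkMatrix, this]

theorem tsum_parkMatrix_col_le (k : ℕ) : ∑' i, |parkMatrix i (k + 2)| ≤ 5 := by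
  have hs := summable_parkMatrix_col (k + 2)
  rw [← hs.sum_add_tsum_nat_add 2]
  have hk : (1 : ℝ) ≤ (k : ℝ) + 1 := by
    have : (0 : ℝ) ≤ k := by positivity
    linarith
  have hk1 : 1 / ((k : ℝ) + 1) ≤ 1 := by rw [div_le_one (by positivity)]; exact hk
  have h2 : (1 : ℝ) ≤ 2 ^ (k + 1) := one_le_pow₀ (by norm_num)
  have hb : 1 / (((k : ℝ) + 1) * 2 ^ (k + 1)) ≤ 1 / 2 ^ (k + 1) := by
    apply one_div_le_one_div_of_le (by positivity)
    nlinarith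
  have hpow : (2 : ℝ) ^ (k + 2) = 2 * 2 ^ (k + 1) := by ring
  have hq : 1 / (2 : ℝ) ^ (k + 1) ≤ 1 := by rw [div_le_one (by positivity)]; exact h2
  have hq0 : 0 ≤ 1 / (2 : ℝ) ^ (k + 1) := by positivity
  have hc : 1 / (2 : ℝ) ^ (k + 2) = 1 / 2 * (1 / 2 ^ (k + 1)) := by rw [hpow]; field_simp
  have hfirst : ∑ i ∈ Finset.range 2, |parkMatrix i (k + 2)| ≤ 5 / 2 + 1 / 2 := by
    simp only [Finset.sum_range_succ, Finset.sum_range_zero, parkMatrix, abs_zero, zero_add]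
    have ha : |(-1 : ℝ) ^ (k + 1) / 2 ^ (k + 2)| = 1 / 2 ^ (k + 2) := by
      rw [abs_div, abs_pow, abs_neg, abs_one, one_pow, abs_of_pos (by positivity)]
    have ha' := abs_le.1 ha.le
    have hn1 : 0 ≤ 1 / ((k : ℝ) + 1) := by positivity
    have hn2 : 0 ≤ 1 / (((k : ℝ) + 1) * 2 ^ (k + 1)) := by positivity
    rw [abs_le]
    constructor <;> linarith [ha'.1, ha'.2]
  have htail : ∑' i, |parkMatrix (i + 2) (k + 2)| ≤ 2 := by
    rw [tsum_eq_sum (s := Finset.range (k + 1)) (fun r hr => by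
      have : (k + 1).choose (r + 1) = 0 := Nat.choose_eq_zero_of_lt (by simp at hr; omega)
      simp [parkMatrix, this])]
    have hterm : ∀ r ∈ Finset.range (k + 1), |parkMatrix (r + 2) (k + 2)| ≤
        ((k + 1).choose (r + 1) : ℝ) * (3 / 2 * (1 / 2 ^ (k + 1))) := by
      intro r _
      simp only [parkMatrix]
      rw [abs_mul, abs_of_nonneg (by positivity : (0 : ℝ) ≤ ((k + 1).choose (r + 1) : ℝ))]
      gcongr
      have ha : |(-1 : ℝ) ^ (k + r) / 2 ^ (k + 2)| = 1 / 2 ^ (k + 2) := by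
        rw [abs_div, abs_pow, abs_neg, abs_one, one_pow, abs_of_pos (by positivity)]
      have ha' := abs_le.1 ha.le
      have hn2 : 0 ≤ 1 / (((k : ℝ) + 1) * 2 ^ (k + 1)) := by positivity
      rw [abs_le]
      constructor <;> linarith [ha'.1, ha'.2]
    refine (Finset.sum_le_sum hterm).trans ?_
    rw [← Finset.sum_mul]
    have hch : ∑ r ∈ Finset.range (k + 1), ((k + 1).choose (r + 1) : ℝ) ≤ 2 ^ (k + 1) := by
      have h := Nat.sum_range_choose (k + 1)
      rw [Finset.sum_range_succ'] at h
      have h' : ∑ r ∈ Finset.range (k + 1), (k + 1).choose (r + 1) ≤ 2 ^ (k + 1) := by omega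
      exact_mod_cast h'
    calc _ ≤ (2 : ℝ) ^ (k + 1) * (3 / 2 * (1 / 2 ^ (k + 1))) := by gcongr
      _ = 3 / 2 := by field_simp
      _ ≤ 2 := by norm_num
  linarith

/-- The columns of the matrix, as elements of `ℓ¹`. -/
def parkCol (j : ℕ) : EllOne :=
  ⟨fun i => parkMatrix i j,
    (memℓp_gen_iff (p := 1) (by simp)).2 (by simpa using summable_parkMatrix_col j)⟩

theorem parkCol_norm_le (j : ℕ) : ‖parkCol j‖ ≤ max 5 (max ‖parkCol 0‖ ‖parkCol 1‖) := by
  match j with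
  | 0 => exact (le_max_left _ _).trans (le_max_right _ _)
  | 1 => exact (le_max_right _ _).trans (le_max_right _ _)
  | k + 2 =>
    refine le_trans ?_ (le_max_left _ _)
    exact (ellOne_mk_norm _).le.trans (tsum_parkMatrix_col_le k)

theorem summable_norm_smul_parkCol (u : EllOne) : Summable fun j => ‖u j • parkCol j‖ := by
  refine Summable.of_nonneg_of_le (fun _ => norm_nonneg _) (fun j => ?_)
    ((ellOne_summable u).mul_right (max 5 (max ‖parkCol 0‖ ‖parkCol 1‖)))
  rw [norm_smul, Real.norm_eq_abs]
  exact mul_le_mul_of_nonneg_left (parkCol_norm_le j) (abs_nonneg _)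

/-- The bounded operator on `ℓ¹` given by the matrix, `u ↦ ∑ⱼ uⱼ · (column j)`. Its coordinates
are the usual ones, see `parkOp_hasSum`. -/
def parkOp : EllOne →L[ℝ] EllOne :=
  LinearMap.mkContinuous
    { toFun := fun u => ∑' j, u j • parkCol j
      map_add' := fun u u' => by
        rw [← (summable_norm_smul_parkCol u).of_norm.tsum_add
          (summable_norm_smul_parkCol u').of_norm]
        exact tsum_congr fun j => by rw [lp.coeFn_add, Pi.add_apply, add_smul]
      map_smul' := fun c u => by
        rw [RingHom.id_apply, ← (summable_norm_smul_parkCol u).of_norm.tsum_const_smul c]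
        exact tsum_congr fun j => by
          rw [lp.coeFn_smul, Pi.smul_apply, smul_eq_mul, mul_smul] }
    (max 5 (max ‖parkCol 0‖ ‖parkCol 1‖)) fun u => by
      refine (norm_tsum_le_tsum_norm (summable_norm_smul_parkCol u)).trans ?_
      rw [mul_comm, ellOne_norm u, ← tsum_mul_right]
      refine (summable_norm_smul_parkCol u).tsum_le_tsum (fun j => ?_)
        ((ellOne_summable u).mul_right _)
      rw [norm_smul, Real.norm_eq_abs]
      exact mul_le_mul_of_nonneg_left (parkCol_norm_le j) (abs_nonneg _)

theorem parkOp_hasSum (u : EllOne) (i : ℕ) :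
    HasSum (fun j => parkMatrix i j * u j) (parkOp u i) := by
  have h := ((summable_norm_smul_parkCol u).of_norm.hasSum).mapL
    (lp.evalCLM ℝ (fun _ : ℕ => ℝ) 1 i)
  have e : (fun j => parkMatrix i j * u j) =
      fun j => lp.evalCLM ℝ (fun _ : ℕ => ℝ) 1 i (u j • parkCol j) := by
    funext j
    rw [mul_comm]
    rfl
  rw [e]
  exact h

/-- `x` is an eigenvector in complex `ℓ¹`, with eigenvalue `z`, of the infinite matrix. -/
def IsComplexEigen (z : ℂ) (x : ℕ → ℂ) : Prop :=
  x ≠ 0 ∧ (Summable fun j => ‖x j‖) ∧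
    ∀ i, HasSum (fun j => (parkMatrix i j : ℂ) * x j) (z * x i)

end

/-! The proof is a cone contraction with explicit constants, valid for the operator and for its
truncations alike. Vectors are normalized by `φ`, the coordinate of index 1. On `ker φ` the
operator, compressed back to `ker φ` along any vector of a small ball around an approximate
eigenvector, contracts a weighted ℓ¹ norm by `q = 21/20`; on the ball itself `φ` grows by at least
`l = 6/5`. Hence the projective action is a `q/l`-contraction of the ball. Its fixed point is an
eigenvector `v` with eigenvalue `μ ≥ l`, and everything transverse to `v` grows at most like `q ^
n`. This gives the bound `q` on all other eigenvalues, the left eigenvector as the norm limit of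
`μ⁻ⁿ φ Tⁿ`, and the convergence of `μ⁻ⁿ Tⁿ x` to `w x • v`.

Truncation shrinks the weighted norm and fixes the approximate eigenvector, so the blocks satisfy
the same estimates (`parkFrame_contracts_parkTrunc`). Right eigenvectors then converge as fixed
points of uniform contractions. Left eigenvectors need more than strong convergence: `w ∘ (T - Tₘ)`
must tend to 0 in norm. It does because `w` lies in `c₀`: the rows of the matrix tend to 0, so its
transpose preserves `c₀`, which is closed in ℓ^∞.

The numerical input is the column estimate `parkCol_bound` and the residual estimate
`approxEigen_residual`. Row 0 and column 1 have only two nonzero entries each, which makes the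
entries of index 0 of `v` and `w` nonzero and permits the required normalization. -/

/-! ### Contraction of a narrow cone and its fixed direction. -/

/-- A seminorm `p` equivalent to the norm, a functional `φ`, a vector `e` with `φ e = 1`, and
constants describing a narrow cone around `v₀`. -/
structure ConeFrame (E : Type*) [NormedAddCommGroup E] [NormedSpace ℝ E] where
  p : Seminorm ℝ E
  φ : E →L[ℝ] ℝ
  e : E
  v₀ : E
  S : ℝ
  q : ℝ
  l : ℝ
  δ : ℝ
  C : ℝ
  norm_le : ∀ x, ‖x‖ ≤ p x
  le_norm : ∀ x, p x ≤ C * ‖x‖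
  φ_e : φ e = 1
  φ_v₀ : φ v₀ = 1
  q_pos : 0 < q
  q_lt_l : q < l
  S_pos : 0 < S
  δ_nonneg : 0 ≤ δ
  le_S : p (v₀ - e) + δ ≤ S

namespace ConeFrame

variable {E : Type*} [NormedAddCommGroup E] [NormedSpace ℝ E] (F : ConeFrame E)

/-- The operator `T` maps the cone of the frame strictly into itself. -/
structure Contracts (T : E →L[ℝ] E) : Prop where
  contr : ∀ k, F.φ k = 0 → F.p (T k - F.φ (T k) • F.e) + F.S * |F.φ (T k)| ≤ F.q * F.p k
  residual : F.p (T F.v₀ - F.φ (T F.v₀) • F.v₀) ≤ (F.l - F.q) * F.δ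
  lower : F.l + F.q / F.S * F.δ ≤ F.φ (T F.v₀)

/-- The section of the cone by the hyperplane `φ = 1`. -/
def base : Set E := {x | F.φ x = 1 ∧ F.p (x - F.v₀) ≤ F.δ}

variable {F} {T : E →L[ℝ] E}

theorem l_pos : 0 < F.l := F.q_pos.trans F.q_lt_l

theorem p_continuous : Continuous F.p := by
  refine (LipschitzWith.of_dist_le' (K := F.C) fun x y => ?_).continuous
  rw [Real.dist_eq, dist_eq_norm]
  exact (abs_sub_map_le_sub F.p x y).trans (F.le_norm _)

theorem v₀_mem_base : F.v₀ ∈ F.base := ⟨F.φ_v₀, by simpa using F.δ_nonneg⟩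

theorem p_sub_e_le {x : E} (hx : x ∈ F.base) : F.p (x - F.e) ≤ F.S := by
  have h : x - F.e = (x - F.v₀) + (F.v₀ - F.e) := by abel
  rw [h]
  linarith [map_add_le_add F.p (x - F.v₀) (F.v₀ - F.e), hx.2, F.le_S]

theorem isClosed_base : IsClosed F.base :=
  (isClosed_eq F.φ.continuous continuous_const).inter
    (isClosed_le (p_continuous.comp (continuous_id.sub continuous_const)) continuous_const)

namespace Contracts

theorem abs_φ_le (hT : F.Contracts T) {k : E} (hk : F.φ k = 0) :
    |F.φ (T k)| ≤ F.q / F.S * F.p k := by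
  have h := hT.contr k hk
  have h0 := apply_nonneg F.p (T k - F.φ (T k) • F.e)
  rw [div_mul_eq_mul_div, le_div_iff₀ F.S_pos]
  linarith

theorem p_compress_le (hT : F.Contracts T) {k : E} (hk : F.φ k = 0) :
    F.p (T k - F.φ (T k) • F.e) ≤ F.q * F.p k := by
  have h := hT.contr k hk
  have h0 := mul_nonneg F.S_pos.le (abs_nonneg (F.φ (T k)))
  linarith

/-- Replacing `e` by `y` costs `|φ (T k)| p (y - e) ≤ S |φ (T k)|`, exactly the term reserved in
`contr`. One estimate at `e` thus serves every direction of the base. -/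
theorem p_sub_smul_le (hT : F.Contracts T) {k y : E} (hk : F.φ k = 0) (hy : y ∈ F.base) :
    F.p (T k - F.φ (T k) • y) ≤ F.q * F.p k := by
  have h : T k - F.φ (T k) • y = (T k - F.φ (T k) • F.e) - F.φ (T k) • (y - F.e) := by
    rw [smul_sub]; abel
  rw [h]
  refine (map_sub_le_add F.p _ _).trans ?_
  rw [map_smul_eq_mul, Real.norm_eq_abs, mul_comm]
  refine le_trans ?_ (hT.contr k hk)
  gcongr
  exact p_sub_e_le hy

/-- Moving from `v₀` to `x` lowers `φ ∘ T` by at most `(q / S) δ`, the margin included in `lower`.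
-/
theorem le_φ (hT : F.Contracts T) {x : E} (hx : x ∈ F.base) : F.l ≤ F.φ (T x) := by
  have hk : F.φ (x - F.v₀) = 0 := by rw [map_sub, hx.1, F.φ_v₀, sub_self]
  have h := hT.abs_φ_le hk
  have h2 : F.q / F.S * F.p (x - F.v₀) ≤ F.q / F.S * F.δ :=
    mul_le_mul_of_nonneg_left hx.2 (div_nonneg F.q_pos.le F.S_pos.le)
  rw [map_sub, map_sub] at h
  have := (abs_le.1 h).1
  linarith [hT.lower]

end Contracts

/-- The projective action of `T` on the hyperplane `φ = 1`. -/
noncomputable def normalized (F : ConeFrame E) (T : E →L[ℝ] E) (x : E) : E := (F.φ (T x))⁻¹ • T x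

namespace Contracts

theorem φ_pos (hT : F.Contracts T) {x : E} (hx : x ∈ F.base) : 0 < F.φ (T x) :=
  F.l_pos.trans_le (hT.le_φ hx)

theorem normalized_mem (hT : F.Contracts T) {x : E} (hx : x ∈ F.base) :
    F.normalized T x ∈ F.base := by
  have hpos := hT.φ_pos hx
  refine ⟨by simp [normalized, inv_mul_cancel₀ hpos.ne'], ?_⟩
  have hk : F.φ (x - F.v₀) = 0 := by rw [map_sub, hx.1, F.φ_v₀, sub_self]
  have h : F.normalized T x - F.v₀ = (F.φ (T x))⁻¹ •
      ((T (x - F.v₀) - F.φ (T (x - F.v₀)) • F.v₀) + (T F.v₀ - F.φ (T F.v₀) • F.v₀)) := by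
    have h1 : (T (x - F.v₀) - F.φ (T (x - F.v₀)) • F.v₀) + (T F.v₀ - F.φ (T F.v₀) • F.v₀)
        = T x - F.φ (T x) • F.v₀ := by
      simp only [map_sub, sub_smul]; abel
    rw [h1, smul_sub, smul_smul, inv_mul_cancel₀ hpos.ne', one_smul, normalized]
  rw [h, map_smul_eq_mul, norm_inv, Real.norm_eq_abs, abs_of_pos hpos, inv_mul_le_iff₀ hpos]
  -- The budget is `q δ` for the contracted deviation plus `(l - q) δ` for the residual, in total `l
  -- δ`, which the division by `φ (T x) ≥ l` brings back to `δ`.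
  have h1 := hT.p_sub_smul_le hk v₀_mem_base
  have h2 := mul_le_mul_of_nonneg_left hx.2 F.q_pos.le
  have h3 := mul_le_mul_of_nonneg_right (hT.le_φ hx) F.δ_nonneg
  linarith [map_add_le_add F.p (T (x - F.v₀) - F.φ (T (x - F.v₀)) • F.v₀)
    (T F.v₀ - F.φ (T F.v₀) • F.v₀), hT.residual]

/-- Compression along `normalized T y` kills `T y`, so the difference is the compressed image of `x
- y` divided by `φ (T x)`: a factor `q` over a factor at least `l`. -/
theorem p_normalized_sub_le (hT : F.Contracts T) {x y : E} (hx : x ∈ F.base) (hy : y ∈ F.base) :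
    F.p (F.normalized T x - F.normalized T y) ≤ F.q / F.l * F.p (x - y) := by
  have hpos := hT.φ_pos hx
  have hposy := hT.φ_pos hy
  have hk : F.φ (x - y) = 0 := by rw [map_sub, hx.1, hy.1, sub_self]
  have h : F.normalized T x - F.normalized T y = (F.φ (T x))⁻¹ •
      (T (x - y) - F.φ (T (x - y)) • F.normalized T y) := by
    have h1 : F.φ (T y) • F.normalized T y = T y := by
      rw [normalized, smul_smul, mul_inv_cancel₀ hposy.ne', one_smul]
    have h2 : T (x - y) - F.φ (T (x - y)) • F.normalized T y
        = T x - F.φ (T x) • F.normalized T y := by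
      simp only [map_sub, sub_smul, h1]; abel
    rw [h2, smul_sub, smul_smul, inv_mul_cancel₀ hpos.ne', one_smul, ← normalized]
  rw [h, map_smul_eq_mul, norm_inv, Real.norm_eq_abs, abs_of_pos hpos, inv_mul_le_iff₀ hpos]
  refine (hT.p_sub_smul_le hk (hT.normalized_mem hy)).trans ?_
  have h0 := apply_nonneg F.p (x - y)
  have : F.q * F.p (x - y) = F.l * (F.q / F.l * F.p (x - y)) := by
    field_simp [F.l_pos.ne']
  rw [this]
  exact mul_le_mul_of_nonneg_right (hT.le_φ hx)
    (mul_nonneg (div_nonneg F.q_pos.le F.l_pos.le) h0)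

/-- Banach iteration from `v₀`, written out because the contraction holds for `p` and completeness
for the norm. -/
theorem exists_eigenvector [CompleteSpace E] (hT : F.Contracts T) :
    ∃ v ∈ F.base, ∃ μ, F.l ≤ μ ∧ T v = μ • v := by
  set x : ℕ → E := fun n => (F.normalized T)^[n] F.v₀ with hx
  have hmem : ∀ n, x n ∈ F.base := by
    intro n
    induction n with
    | zero => exact v₀_mem_base
    | succ n ih =>
      simp only [hx, Function.iterate_succ_apply']
      exact hT.normalized_mem ih
  have hρ0 : 0 ≤ F.q / F.l := div_nonneg F.q_pos.le F.l_pos.le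
  have hρ : F.q / F.l < 1 := (div_lt_one F.l_pos).2 F.q_lt_l
  have hstep : ∀ n, F.p (x n - x (n + 1)) ≤ F.p (x 0 - x 1) * (F.q / F.l) ^ n := by
    intro n
    induction n with
    | zero => simp
    | succ n ih =>
      have h := hT.p_normalized_sub_le (hmem n) (hmem (n + 1))
      have h1 : ∀ n, x (n + 1) = F.normalized T (x n) := fun n => by
        simp only [hx, Function.iterate_succ_apply']
      rw [h1 n, h1 (n + 1)]
      refine h.trans ?_
      calc _ ≤ F.q / F.l * (F.p (x 0 - x 1) * (F.q / F.l) ^ n) := by gcongr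
        _ = _ := by ring
  have hC : CauchySeq x := by
    refine cauchySeq_of_le_geometric (F.q / F.l) (F.p (x 0 - x 1)) hρ fun n => ?_
    rw [dist_eq_norm]
    exact (F.norm_le _).trans (hstep n)
  obtain ⟨v, hv⟩ := cauchySeq_tendsto_of_complete hC
  have hvm : v ∈ F.base := isClosed_base.mem_of_tendsto hv (Eventually.of_forall hmem)
  refine ⟨v, hvm, F.φ (T v), hT.le_φ hvm, ?_⟩
  have h1 : Tendsto (fun n => F.φ (T (x n)) • x (n + 1)) atTop (𝓝 (F.φ (T v) • v)) :=
    ((F.φ.continuous.tendsto _).comp ((T.continuous.tendsto _).comp hv)).smul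
      (hv.comp (tendsto_add_atTop_nat 1))
  have h2 : Tendsto (fun n => T (x n)) atTop (𝓝 (T v)) := (T.continuous.tendsto _).comp hv
  refine tendsto_nhds_unique h2 (h1.congr fun n => ?_)
  simp only [hx, Function.iterate_succ_apply', normalized]
  rw [smul_smul, mul_inv_cancel₀ (hT.φ_pos (hmem n)).ne', one_smul]

end Contracts

/-! ### Spectral gap and left eigenvector. -/

variable {v : E} {μ : ℝ}

namespace Contracts

theorem φ_sub_smul (hv : v ∈ F.base) (x : E) : F.φ (x - F.φ x • v) = 0 := by
  rw [map_sub, map_smul, hv.1, smul_eq_mul, mul_one, sub_self]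

/-- As `v` is an eigenvector, `T` descends to the quotient by the line of `v`, where `p` of the
representative in `ker φ` contracts by `q`. -/
theorem p_apply_sub_le (hT : F.Contracts T) (hv : v ∈ F.base) (hTv : T v = μ • v) (x : E) :
    F.p (T x - F.φ (T x) • v) ≤ F.q * F.p (x - F.φ x • v) := by
  have h := hT.p_sub_smul_le (φ_sub_smul hv x) hv
  have e : T (x - F.φ x • v) - F.φ (T (x - F.φ x • v)) • v = T x - F.φ (T x) • v := by
    rw [map_sub, map_smul, hTv, map_sub, map_smul, map_smul, hv.1, sub_smul]
    simp only [smul_eq_mul, mul_one, smul_smul]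
    abel
  rwa [e] at h

theorem p_pow_sub_le (hT : F.Contracts T) (hv : v ∈ F.base) (hTv : T v = μ • v) (x : E) (n : ℕ) :
    F.p ((T ^ n) x - F.φ ((T ^ n) x) • v) ≤ F.q ^ n * F.p (x - F.φ x • v) := by
  induction n with
  | zero => simp
  | succ n ih =>
    rw [pow_succ' T, mul_apply_eq_comp]
    refine (hT.p_apply_sub_le hv hTv _).trans ?_
    rw [pow_succ', mul_assoc]
    exact mul_le_mul_of_nonneg_left ih F.q_pos.le

theorem eq_smul_of_p_eq_zero {x : E} (h : F.p (x - F.φ x • v) = 0) : x = F.φ x • v := by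
  have := F.norm_le (x - F.φ x • v)
  rw [h] at this
  exact sub_eq_zero.1 (norm_le_zero_iff.1 this)

/-- A complex eigenvalue, given by real and imaginary parts of an eigenvector. -/
theorem norm_le_of_complex_eigen (hT : F.Contracts T) (hv : v ∈ F.base) (hTv : T v = μ • v)
    {z : ℂ} {a b : E} (hab : a ≠ 0 ∨ b ≠ 0) (ha : T a = z.re • a - z.im • b)
    (hb : T b = z.im • a + z.re • b) (hz : z ≠ μ) : ‖z‖ ≤ F.q := by
  by_contra! hlt
  have hz0 : 0 < ‖z‖ := F.q_pos.trans hlt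
  have hpow : ∀ n : ℕ, (T ^ n) a = (z ^ n).re • a - (z ^ n).im • b ∧
      (T ^ n) b = (z ^ n).im • a + (z ^ n).re • b := by
    intro n
    induction n with
    | zero => simp
    | succ n ih =>
      rw [pow_succ' T, mul_apply_eq_comp, mul_apply_eq_comp, ih.1, ih.2,
        pow_succ z]
      simp only [map_sub, map_add, map_smul, ha, hb, Complex.mul_re, Complex.mul_im]
      constructor <;> module
  set M := F.p (a - F.φ a • v) + F.p (b - F.φ b • v) with hM
  have key : ∀ n : ℕ, ‖z‖ ^ n * F.p (a - F.φ a • v) ≤ F.q ^ n * M ∧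
      ‖z‖ ^ n * F.p (b - F.φ b • v) ≤ F.q ^ n * M := by
    intro n
    have hA := hT.p_pow_sub_le hv hTv a n
    have hB := hT.p_pow_sub_le hv hTv b n
    obtain ⟨e1, e2⟩ := hpow n
    set c := (z ^ n).re with hc
    set s := (z ^ n).im with hs
    have hcs : c * c + s * s = ‖z‖ ^ n * ‖z‖ ^ n := by
      rw [← norm_pow, Complex.norm_mul_self_eq_normSq, Complex.normSq_apply]
    have hc1 : |c| ≤ ‖z‖ ^ n := by rw [← norm_pow]; exact Complex.abs_re_le_norm _
    have hs1 : |s| ≤ ‖z‖ ^ n := by rw [← norm_pow]; exact Complex.abs_im_le_norm _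
    set X := (T ^ n) a - F.φ ((T ^ n) a) • v with hX
    set Y := (T ^ n) b - F.φ ((T ^ n) b) • v with hY
    -- `Tⁿ` acts on the pair `(a, b)` as multiplication by `z ^ n`; multiplying by its conjugate
    -- recovers the initial pair, so the transverse parts are at most `(q / ‖z‖) ^ n M`.
    have g1 : (‖z‖ ^ n * ‖z‖ ^ n) • (a - F.φ a • v) = c • X + s • Y := by
      rw [← hcs, hX, hY, e1, e2]
      simp only [map_sub, map_add, map_smul, smul_eq_mul]
      module
    have g2 : (‖z‖ ^ n * ‖z‖ ^ n) • (b - F.φ b • v) = c • Y - s • X := by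
      rw [← hcs, hX, hY, e1, e2]
      simp only [map_sub, map_add, map_smul, smul_eq_mul]
      module
    have hzn : 0 < ‖z‖ ^ n := by positivity
    have hp1 : ∀ {t : ℝ} {Z : E}, |t| ≤ ‖z‖ ^ n → F.p (t • Z) ≤ ‖z‖ ^ n * F.p Z := by
      intro t Z ht
      rw [map_smul_eq_mul, Real.norm_eq_abs]
      exact mul_le_mul_of_nonneg_right ht (apply_nonneg _ _)
    have hXY : F.p X + F.p Y ≤ F.q ^ n * M := by rw [hM, mul_add]; linarith
    have fin : ∀ {Z : E}, F.p ((‖z‖ ^ n * ‖z‖ ^ n) • Z) ≤ ‖z‖ ^ n * (F.p X + F.p Y) →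
        ‖z‖ ^ n * F.p Z ≤ F.q ^ n * M := by
      intro Z h
      rw [map_smul_eq_mul, Real.norm_eq_abs, abs_of_pos (by positivity), mul_assoc] at h
      exact (le_of_mul_le_mul_left h hzn).trans hXY
    constructor
    · apply fin
      rw [g1, mul_add]
      exact (map_add_le_add F.p _ _).trans (add_le_add (hp1 hc1) (hp1 hs1))
    · apply fin
      rw [g2, mul_add]
      refine (map_sub_le_add F.p _ _).trans ?_
      rw [add_comm]
      exact add_le_add (hp1 hs1) (hp1 hc1)
  have zero : ∀ t : ℝ, 0 ≤ t → (∀ n : ℕ, ‖z‖ ^ n * t ≤ F.q ^ n * M) → t = 0 := by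
    intro t ht h
    have hlim : Tendsto (fun n : ℕ => (F.q / ‖z‖) ^ n * M) atTop (𝓝 (0 * M)) :=
      (tendsto_pow_atTop_nhds_zero_of_lt_one (div_nonneg F.q_pos.le hz0.le)
        ((div_lt_one hz0).2 hlt)).mul_const M
    rw [zero_mul] at hlim
    refine le_antisymm (ge_of_tendsto' hlim fun n => ?_) ht
    rw [div_pow, div_mul_eq_mul_div, le_div_iff₀ (by positivity), mul_comm]
    exact h n
  -- Both parts are now multiples of `v`, and applying `φ` leaves a scalar equation that forces `z =
  -- μ`.
  have ea := eq_smul_of_p_eq_zero (zero _ (apply_nonneg _ _) fun n => (key n).1)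
  have eb := eq_smul_of_p_eq_zero (zero _ (apply_nonneg _ _) fun n => (key n).2)
  have h1 := congrArg F.φ ha
  have h2 := congrArg F.φ hb
  rw [ea, eb] at h1 h2
  simp only [map_sub, map_add, map_smul, hTv, hv.1, smul_eq_mul, mul_one] at h1 h2
  have h3 : ((μ : ℂ) - z) * (⟨F.φ a, F.φ b⟩ : ℂ) = 0 := by
    apply Complex.ext
    · simp; linarith
    · simp; linarith
  rcases mul_eq_zero.1 h3 with h | h
  · exact hz (sub_eq_zero.1 h).symm
  · have h4 := congrArg Complex.re h
    have h5 := congrArg Complex.im h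
    simp only [Complex.zero_re, Complex.zero_im] at h4 h5
    rw [h4, zero_smul] at ea
    rw [h5, zero_smul] at eb
    exact hab.elim (fun h => h ea) (fun h => h eb)

/-- Consecutive functionals `μ⁻ⁿ φ Tⁿ` agree on the `v`-part of `Tⁿ x`, so their difference sees
only the transverse part, of order `q ^ n`. They form a Cauchy sequence in norm, with ratio `q / μ`.
-/
theorem exists_left_eigen (hT : F.Contracts T) (hv : v ∈ F.base) (hTv : T v = μ • v)
    (hμ : F.l ≤ μ) :
    ∃ w : E →L[ℝ] ℝ, (∀ x, w (T x) = μ * w x) ∧ w v = 1 ∧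
      Tendsto (fun n : ℕ => (μ ^ n)⁻¹ • F.φ.comp (T ^ n)) atTop (𝓝 w) ∧
      ∀ x, Tendsto (fun n : ℕ => (μ ^ n)⁻¹ • (T ^ n) x) atTop (𝓝 (w x • v)) := by
  have hμ0 : 0 < μ := F.l_pos.trans_le hμ
  have hq := F.q_pos
  have hqμ : F.q < μ := F.q_lt_l.trans_le hμ
  set r : E →L[ℝ] E := ContinuousLinearMap.id ℝ E - F.φ.smulRight v with hr
  have hrx : ∀ x, r x = x - F.φ x • v := fun x => by simp [hr]
  set D := |F.C| * ‖r‖ with hD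
  have hN : ∀ x, F.p (x - F.φ x • v) ≤ D * ‖x‖ := by
    intro x
    rw [← hrx]
    refine (F.le_norm _).trans ?_
    calc _ ≤ |F.C| * (‖r‖ * ‖x‖) := by
          gcongr
          · exact le_abs_self _
          · exact r.le_opNorm x
      _ = _ := by rw [hD]; ring
  set g : ℕ → (E →L[ℝ] ℝ) := fun n => (μ ^ n)⁻¹ • F.φ.comp (T ^ n) with hg
  have hdist : ∀ n, dist (g n) (g (n + 1)) ≤ (F.q / F.S * D / μ) * (F.q / μ) ^ n := by
    intro n
    rw [dist_eq_norm]
    have hD0 : 0 ≤ D := by positivity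
    have hS := F.S_pos
    refine ContinuousLinearMap.opNorm_le_bound _ (by positivity) fun x => ?_
    have h1 := hT.abs_φ_le (φ_sub_smul hv ((T ^ n) x))
    have h2 := hT.p_pow_sub_le hv hTv x n
    have e : (g n - g (n + 1)) x = -(μ ^ (n + 1))⁻¹ *
        F.φ (T ((T ^ n) x - F.φ ((T ^ n) x) • v)) := by
      rw [map_sub, map_smul, hTv, map_sub, map_smul, map_smul, hv.1]
      simp only [hg, sub_apply, smul_apply,
        ContinuousLinearMap.comp_apply, pow_succ' T, mul_apply_eq_comp, smul_eq_mul]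
      field_simp
      ring
    rw [e, norm_mul, norm_neg, norm_inv, Real.norm_eq_abs, Real.norm_eq_abs,
      abs_of_pos (by positivity)]
    calc _ ≤ (μ ^ (n + 1))⁻¹ * (F.q / F.S * (F.q ^ n * (D * ‖x‖))) := by
          gcongr
          refine h1.trans ?_
          gcongr
          refine h2.trans ?_
          gcongr
          exact hN x
      _ = _ := by rw [div_pow]; field_simp; ring
  have hCauchy : CauchySeq g := cauchySeq_of_le_geometric _ _ ((div_lt_one hμ0).2 hqμ) hdist
  obtain ⟨w, hw⟩ := cauchySeq_tendsto_of_complete hCauchy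
  have hwx : ∀ x, Tendsto (fun n => g n x) atTop (𝓝 (w x)) := fun x =>
    ((ContinuousLinearMap.apply ℝ ℝ x).continuous.tendsto w).comp hw
  have hpowv : ∀ n : ℕ, (T ^ n) v = μ ^ n • v := by
    intro n
    induction n with
    | zero => simp
    | succ n ih =>
      rw [pow_succ' T, mul_apply_eq_comp, ih, map_smul, hTv, smul_smul, pow_succ]
  refine ⟨w, fun x => ?_, ?_, hw, fun x => ?_⟩
  · refine tendsto_nhds_unique (hwx (T x)) ?_
    have h := ((hwx x).comp (tendsto_add_atTop_nat 1)).const_mul μ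
    refine h.congr fun n => ?_
    simp only [hg, Function.comp, smul_apply, ContinuousLinearMap.comp_apply,
      pow_succ T, mul_apply_eq_comp, smul_eq_mul]
    field_simp
    ring
  · refine tendsto_nhds_unique (hwx v) (tendsto_const_nhds.congr fun n => ?_)
    simp only [hg, smul_apply, ContinuousLinearMap.comp_apply, hpowv, map_smul,
      hv.1, smul_eq_mul]
    field_simp
  · have h1 : Tendsto (fun n => g n x • v) atTop (𝓝 (w x • v)) := (hwx x).smul_const v
    have h2 : Tendsto (fun n : ℕ => (μ ^ n)⁻¹ • ((T ^ n) x - F.φ ((T ^ n) x) • v)) atTop (𝓝 0) := by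
      have hlim : Tendsto (fun n : ℕ => (F.q / μ) ^ n * F.p (x - F.φ x • v)) atTop
          (𝓝 (0 * F.p (x - F.φ x • v))) :=
        (tendsto_pow_atTop_nhds_zero_of_lt_one (div_nonneg hq.le hμ0.le)
          ((div_lt_one hμ0).2 hqμ)).mul_const _
      rw [zero_mul] at hlim
      refine squeeze_zero_norm (fun n => ?_) hlim
      rw [norm_smul, norm_inv, Real.norm_eq_abs, abs_of_pos (by positivity), div_pow,
        div_mul_eq_mul_div, inv_mul_eq_div]
      gcongr
      exact (F.norm_le _).trans (hT.p_pow_sub_le hv hTv x n)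
    have h3 := h1.add h2
    rw [add_zero] at h3
    refine h3.congr fun n => ?_
    simp only [hg, smul_apply, ContinuousLinearMap.comp_apply, smul_sub,
      smul_smul, smul_eq_mul]
    abel

end Contracts

/-- A bound on `ker φ` that improves by a factor `ρ < 1` as long as it exceeds `M₀`. -/
theorem abs_le_of_improving (F : ConeFrame E) (L : E →L[ℝ] ℝ) {M₀ ρ : ℝ} (hM₀ : 0 ≤ M₀)
    (hρ0 : 0 ≤ ρ) (hρ : ρ < 1)
    (h : ∀ M, M₀ ≤ M → (∀ k, F.φ k = 0 → |L k| ≤ M * F.p k) →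
      ∀ k, F.φ k = 0 → |L k| ≤ ρ * M * F.p k) {k : E} (hk : F.φ k = 0) :
    |L k| ≤ M₀ * F.p k := by
  -- Continuity of `L` supplies a finite initial bound; each improvement shrinks only its excess
  -- over `M₀`.
  have key : ∀ n : ℕ, ∀ k, F.φ k = 0 → |L k| ≤ (M₀ + ρ ^ n * ‖L‖) * F.p k := by
    intro n
    induction n with
    | zero =>
      intro k _
      have h1 := L.le_opNorm k
      rw [Real.norm_eq_abs] at h1
      have h2 := mul_le_mul_of_nonneg_left (F.norm_le k) (norm_nonneg L)
      have h3 := mul_nonneg hM₀ (apply_nonneg F.p k)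
      rw [pow_zero, one_mul, add_mul]
      linarith
    | succ n ih =>
      intro k hk
      refine (h _ (by have := mul_nonneg (pow_nonneg hρ0 n) (norm_nonneg L); linarith) ih k hk).trans
        (mul_le_mul_of_nonneg_right ?_ (apply_nonneg _ _))
      rw [mul_add, pow_succ']
      nlinarith
  have hlim : Tendsto (fun n : ℕ => (M₀ + ρ ^ n * ‖L‖) * F.p k) atTop
      (𝓝 ((M₀ + 0 * ‖L‖) * F.p k)) :=
    (((tendsto_pow_atTop_nhds_zero_of_lt_one hρ0 hρ).mul_const _).const_add _).mul_const _
  rw [zero_mul, add_zero] at hlim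
  exact ge_of_tendsto' hlim fun n => key n k hk

namespace Contracts

variable {w : E →L[ℝ] ℝ}

/-- On `ker φ` the functional `w` is controlled by `|w e| / S`, by self-improvement through `μ w k =
w (T k)`. Since `p (v - e) ≤ S`, `w v = 1` differs from `w e` by at most `(q / μ) |w e|`, which
excludes `w e ≤ 0`. -/
theorem left_eigen_e_pos (hT : F.Contracts T) (hv : v ∈ F.base) (hμ : F.l ≤ μ)
    (hw : ∀ x, w (T x) = μ * w x) (hwv : w v = 1) : 0 < w F.e := by
  have hμ0 : 0 < μ := F.l_pos.trans_le hμ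
  have hqμ : F.q < μ := F.q_lt_l.trans_le hμ
  have hS := F.S_pos
  have improve : ∀ M, |w F.e| / F.S ≤ M → (∀ k, F.φ k = 0 → |w k| ≤ M * F.p k) →
      ∀ k, F.φ k = 0 → |w k| ≤ F.q / μ * M * F.p k := by
    intro M hM h k hk
    have hd : F.φ (T k - F.φ (T k) • F.e) = 0 := by
      rw [map_sub, map_smul, F.φ_e, smul_eq_mul, mul_one, sub_self]
    have h1 := h _ hd
    have h2 : μ * w k = F.φ (T k) * w F.e + w (T k - F.φ (T k) • F.e) := by
      rw [← hw, map_sub w, map_smul, smul_eq_mul]; ring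
    have h3 : μ * |w k| ≤ |F.φ (T k)| * |w F.e| + M * F.p (T k - F.φ (T k) • F.e) := by
      rw [← abs_of_pos hμ0, ← abs_mul, h2, ← abs_mul]
      exact (abs_add_le _ _).trans (add_le_add le_rfl h1)
    rw [div_le_iff₀ hS] at hM
    have hM0 : 0 ≤ M := by
      by_contra! hneg
      nlinarith [abs_nonneg (w F.e)]
    have h4 := mul_le_mul_of_nonneg_left (hT.contr k hk) hM0
    have h5 := mul_le_mul_of_nonneg_left hM (abs_nonneg (F.φ (T k)))
    -- The threshold `|w e| ≤ M S` lets the term `S |φ (T k)|` of `contr` absorb the contribution of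
    -- `w e`.
    have h6 : F.q / μ * M * F.p k = (M * (F.q * F.p k)) / μ := by ring
    rw [h6, le_div_iff₀ hμ0]
    linarith
  have hρ0 : 0 ≤ F.q / μ := div_nonneg F.q_pos.le hμ0.le
  have hρ1 : F.q / μ < 1 := (div_lt_one hμ0).2 hqμ
  have bound := fun k hk => F.abs_le_of_improving w (by positivity) hρ0 hρ1 improve (k := k) hk
  have hk : F.φ (v - F.e) = 0 := by rw [map_sub, hv.1, F.φ_e, sub_self]
  have h1 := improve _ le_rfl bound _ hk
  have h2 : F.q / μ * (|w F.e| / F.S) * F.p (v - F.e) ≤ F.q / μ * |w F.e| := by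
    rw [mul_assoc]
    gcongr
    rw [div_mul_eq_mul_div, div_le_iff₀ hS]
    gcongr
    exact p_sub_e_le hv
  rw [map_sub, hwv] at h1
  by_contra! hneg
  rw [abs_of_nonpos hneg] at h2 h1
  have h3 := (abs_le.1 (h1.trans h2)).2
  nlinarith

/-- Apply `w'` to `μ⁻ⁿ Tⁿ x → w x • v`: the left side is constantly `w' x`. -/
theorem left_eigen_unique
    (hlim : ∀ x, Tendsto (fun n : ℕ => (μ ^ n)⁻¹ • (T ^ n) x) atTop (𝓝 (w x • v))) (hμ0 : 0 < μ)
    {w' : E →L[ℝ] ℝ} (hw' : ∀ x, w' (T x) = μ * w' x) (x : E) : w' x = w x * w' v := by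
  have hpow : ∀ n : ℕ, w' ((T ^ n) x) = μ ^ n * w' x := by
    intro n
    induction n with
    | zero => simp
    | succ n ih => rw [pow_succ' T, mul_apply_eq_comp, hw', ih]; ring
  have h := (w'.continuous.tendsto _).comp (hlim x)
  rw [map_smul, smul_eq_mul] at h
  refine tendsto_nhds_unique (tendsto_const_nhds.congr fun n => ?_) h
  simp only [Function.comp, map_smul, hpow, smul_eq_mul]
  field_simp

/-- The transverse part of `x` is multiplied by `μ > q` and yet contracted by `q`. -/
theorem right_eigen_unique (hT : F.Contracts T) (hv : v ∈ F.base) (hTv : T v = μ • v)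
    (hμ : F.l ≤ μ) {x : E} (hx : T x = μ • x) : x = F.φ x • v := by
  have h := hT.p_apply_sub_le hv hTv x
  have e : T x - F.φ (T x) • v = μ • (x - F.φ x • v) := by
    rw [hx, map_smul, smul_eq_mul, smul_sub, smul_smul]
  rw [e, map_smul_eq_mul, Real.norm_eq_abs, abs_of_pos (F.l_pos.trans_le hμ)] at h
  have h0 := apply_nonneg F.p (x - F.φ x • v)
  have hqμ : F.q < μ := F.q_lt_l.trans_le hμ
  exact eq_smul_of_p_eq_zero (by nlinarith)

end Contracts

/-! ### Stability of the eigendata under approximation of the operator. -/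

section Limits

variable {Tm : ℕ → E →L[ℝ] E} {vm : ℕ → E} {μm : ℕ → ℝ} {m₀ : ℕ}

/-- Fixed points of uniform contractions: the distance from `vm m` to `v` is at most `(1 - q / l)⁻¹`
times the displacement of `v` under the `m`-th projective map. Strong convergence suffices. -/
theorem tendsto_right_eigen (hT : F.Contracts T) (hTm : ∀ m, m₀ ≤ m → F.Contracts (Tm m))
    (hlim : ∀ x, Tendsto (fun m => Tm m x) atTop (𝓝 (T x)))
    (hv : v ∈ F.base) (hTv : T v = μ • v) (hμ : F.l ≤ μ)
    (hvm : ∀ m, m₀ ≤ m → vm m ∈ F.base) (hTvm : ∀ m, m₀ ≤ m → Tm m (vm m) = μm m • vm m)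
    (hμm : ∀ m, m₀ ≤ m → F.l ≤ μm m) :
    Tendsto vm atTop (𝓝 v) := by
  have hl := F.l_pos
  have fixed : ∀ {T : E →L[ℝ] E} {v : E} {μ : ℝ}, v ∈ F.base → T v = μ • v → F.l ≤ μ →
      F.normalized T v = v := by
    intro T v μ hv hTv hμ
    rw [normalized, hTv, map_smul, hv.1, smul_eq_mul, mul_one, smul_smul,
      inv_mul_cancel₀ (hl.trans_le hμ).ne', one_smul]
  have hf : Tendsto (fun m => F.normalized (Tm m) v) atTop (𝓝 (F.normalized T v)) :=
    (((F.φ.continuous.tendsto _).comp (hlim v)).inv₀ (hT.φ_pos hv).ne').smul (hlim v)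
  have hp : Tendsto (fun m => F.p (F.normalized (Tm m) v - v)) atTop (𝓝 0) := by
    have h := (p_continuous (F := F)).tendsto (F.normalized T v - v)
    have h' := h.comp (hf.sub_const v)
    rwa [fixed hv hTv hμ, sub_self, map_zero] at h'
  have hρ : F.q / F.l < 1 := (div_lt_one hl).2 F.q_lt_l
  rw [tendsto_iff_norm_sub_tendsto_zero]
  have hp' := hp.div_const (1 - F.q / F.l)
  rw [zero_div] at hp'
  refine squeeze_zero' (Eventually.of_forall fun _ => norm_nonneg _) ?_ hp'
  filter_upwards [eventually_ge_atTop m₀] with m hm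
  refine (F.norm_le _).trans ?_
  rw [le_div_iff₀ (by linarith)]
  have h1 := (hTm m hm).p_normalized_sub_le (hvm m hm) hv
  rw [fixed (hvm m hm) (hTvm m hm) (hμm m hm)] at h1
  have h2 := map_add_le_add F.p (vm m - F.normalized (Tm m) v) (F.normalized (Tm m) v - v)
  rw [sub_add_sub_cancel] at h2
  nlinarith

theorem tendsto_eigenvalue (hv : v ∈ F.base) (hTv : T v = μ • v)
    (hlim : ∀ x, Tendsto (fun m => Tm m x) atTop (𝓝 (T x))) {B : ℝ} (hB : ∀ m, ‖Tm m‖ ≤ B)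
    (hvm : ∀ m, m₀ ≤ m → vm m ∈ F.base) (hTvm : ∀ m, m₀ ≤ m → Tm m (vm m) = μm m • vm m)
    (hvlim : Tendsto vm atTop (𝓝 v)) : Tendsto μm atTop (𝓝 μ) := by
  have h1 : Tendsto (fun m => Tm m (vm m)) atTop (𝓝 (T v)) := by
    have h2 : Tendsto (fun m => Tm m (vm m - v)) atTop (𝓝 0) := by
      have h3 := (tendsto_iff_norm_sub_tendsto_zero.1 hvlim).const_mul B
      rw [mul_zero] at h3
      exact squeeze_zero_norm (fun m => (Tm m).le_of_opNorm_le (hB m) _) h3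
    have h4 := h2.add (hlim v)
    rw [zero_add] at h4
    exact h4.congr fun m => by rw [map_sub, sub_add_cancel]
  have h5 := (F.φ.continuous.tendsto _).comp h1
  rw [hTv, map_smul, hv.1, smul_eq_mul, mul_one] at h5
  refine h5.congr' ?_
  filter_upwards [eventually_ge_atTop m₀] with m hm
  simp [hTvm m hm, (hvm m hm).1]

/-- The difference `D = wm m - w` vanishes at `e` and satisfies `μm D = D ∘ Tm - (μm - μ) w - w ∘ (T
- Tm)`. On `ker φ` the first term contracts by `q` and the others have size at most `ε m`, so `D` is
of order `ε m`. -/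
theorem tendsto_left_eigen {w : E →L[ℝ] ℝ} {wm : ℕ → E →L[ℝ] ℝ}
    (hTm : ∀ m, m₀ ≤ m → F.Contracts (Tm m))
    (hμm : ∀ m, m₀ ≤ m → F.l ≤ μm m) (hμlim : Tendsto μm atTop (𝓝 μ))
    (hw : ∀ x, w (T x) = μ * w x) (hwe : w F.e = 1)
    (hwm : ∀ m, m₀ ≤ m → ∀ x, wm m (Tm m x) = μm m * wm m x)
    (hwme : ∀ m, m₀ ≤ m → wm m F.e = 1)
    (hwT : Tendsto (fun m => ‖w.comp (T - Tm m)‖) atTop (𝓝 0)) :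
    Tendsto wm atTop (𝓝 w) := by
  have hl := F.l_pos
  have hql := F.q_lt_l
  have hq := F.q_pos
  set ε : ℕ → ℝ := fun m => |μm m - μ| * ‖w‖ + ‖w.comp (T - Tm m)‖ with hε
  have hεlim : Tendsto ε atTop (𝓝 0) := by
    have h1 := (hμlim.sub_const μ).abs.mul_const ‖w‖
    rw [sub_self, abs_zero, zero_mul] at h1
    have := h1.add hwT
    rwa [add_zero] at this
  have hε0 : ∀ m, 0 ≤ ε m := fun m => by positivity
  set r : E →L[ℝ] E := ContinuousLinearMap.id ℝ E - F.φ.smulRight F.e with hr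
  have hrx : ∀ x, r x = x - F.φ x • F.e := fun x => by simp [hr]
  have bound : ∀ m, m₀ ≤ m → ‖wm m - w‖ ≤ 2 * ε m / (F.l - F.q) * (|F.C| * ‖r‖) := by
    intro m hm
    have hD : (wm m - w) F.e = 0 := by
      rw [sub_apply, hwe, hwme m hm, sub_self]
    -- Above this threshold `ε m ≤ M (l - q) / 2`, so `q M + ε m` is at most the midpoint `(q + l) /
    -- 2` times `M`.
    have improve : ∀ M, 2 * ε m / (F.l - F.q) ≤ M →
        (∀ k, F.φ k = 0 → |(wm m - w) k| ≤ M * F.p k) →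
        ∀ k, F.φ k = 0 → |(wm m - w) k| ≤ (F.q + F.l) / (2 * F.l) * M * F.p k := by
      intro M hM h k hk
      have hd : F.φ (Tm m k - F.φ (Tm m k) • F.e) = 0 := by
        rw [map_sub, map_smul, F.φ_e, smul_eq_mul, mul_one, sub_self]
      have h1 := h _ hd
      rw [map_sub (wm m - w), map_smul, hD, smul_zero, sub_zero] at h1
      have h2 : μm m * (wm m - w) k = (wm m - w) (Tm m k) - (μm m - μ) * w k
          - w.comp (T - Tm m) k := by
        simp only [sub_apply, ContinuousLinearMap.comp_apply, map_sub, hw,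
          hwm m hm]
        ring
      have hpk := F.norm_le k
      have h3 : |(μm m - μ) * w k| ≤ |μm m - μ| * ‖w‖ * F.p k := by
        rw [abs_mul, mul_assoc]
        gcongr
        exact (w.le_opNorm k).trans (by gcongr)
      have h4 : |w.comp (T - Tm m) k| ≤ ‖w.comp (T - Tm m)‖ * F.p k :=
        ((w.comp (T - Tm m)).le_opNorm k).trans (by gcongr)
      have hM0 : 0 ≤ M := le_trans (div_nonneg (by linarith [hε0 m]) (by linarith)) hM
      have h5 : μm m * |(wm m - w) k| ≤ M * (F.q * F.p k) + ε m * F.p k := by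
        rw [← abs_of_pos (hl.trans_le (hμm m hm)), ← abs_mul, h2]
        have h6 := mul_le_mul_of_nonneg_left ((hTm m hm).p_compress_le hk) hM0
        have h7 := abs_sub ((wm m - w) (Tm m k) - (μm m - μ) * w k) (w.comp (T - Tm m) k)
        have h8 := abs_sub ((wm m - w) (Tm m k)) ((μm m - μ) * w k)
        have h9 : ε m * F.p k = |μm m - μ| * ‖w‖ * F.p k + ‖w.comp (T - Tm m)‖ * F.p k := by
          rw [hε]; ring
        linarith
      have h10 : F.l * |(wm m - w) k| ≤ μm m * |(wm m - w) k| :=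
        mul_le_mul_of_nonneg_right (hμm m hm) (abs_nonneg _)
      rw [div_le_iff₀ (by linarith)] at hM
      have h11 := mul_le_mul_of_nonneg_right hM (apply_nonneg F.p k)
      have h12 : (F.q + F.l) / (2 * F.l) * M * F.p k = ((F.q + F.l) * M * F.p k / 2) / F.l := by
        field_simp
      rw [h12, le_div_iff₀ hl]
      nlinarith
    refine ContinuousLinearMap.opNorm_le_bound _ ?_ fun x => ?_
    · have := hε0 m
      have : 0 < F.l - F.q := by linarith
      positivity
    · have hk : F.φ (r x) = 0 := by
        rw [hrx, map_sub, map_smul, F.φ_e, smul_eq_mul, mul_one, sub_self]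
      have h := F.abs_le_of_improving (wm m - w)
        (div_nonneg (by linarith [hε0 m]) (by linarith)) (by positivity)
        ((div_lt_one (by linarith)).2 (by linarith)) improve hk
      rw [hrx, map_sub, map_smul, hD, smul_zero, sub_zero, ← hrx] at h
      rw [mul_assoc]
      refine h.trans (mul_le_mul_of_nonneg_left ?_ (div_nonneg (by linarith [hε0 m]) (by linarith)))
      refine (F.le_norm _).trans ?_
      rw [mul_assoc]
      gcongr
      · exact le_abs_self _
      · exact r.le_opNorm x
  rw [tendsto_iff_norm_sub_tendsto_zero]
  have hb := ((hεlim.const_mul 2).div_const (F.l - F.q)).mul_const (|F.C| * ‖r‖)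
  rw [mul_zero, zero_div, zero_mul] at hb
  refine squeeze_zero' (Eventually.of_forall fun _ => norm_nonneg _) ?_ hb
  filter_upwards [eventually_ge_atTop m₀] with m hm using bound m hm

end Limits

end ConeFrame

/-! ### Numerical bounds for the entries and the columns. -/

/-- The tail `∑_{j ≥ r + 1} 1 / (j 3ʲ)` of the logarithmic series. -/
noncomputable def logTail (r : ℕ) : ℝ := ∑' j : ℕ, 1 / (((j : ℝ) + r + 1) * 3 ^ (j + r + 1))

theorem logTail_term_le (r j : ℕ) : 1 / (((j : ℝ) + r + 1) * 3 ^ (j + r + 1)) ≤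
    1 / (((r : ℝ) + 1) * 3 ^ (r + 1)) * (1 / 3 : ℝ) ^ j := by
  rw [one_div_pow, ← one_div_mul_one_div_rev, div_mul_div_comm, div_mul_div_comm]
  apply div_le_div₀ (by norm_num) (by norm_num) (by positivity)
  have : (3 : ℝ) ^ (j + r + 1) = 3 ^ (r + 1) * 3 ^ j := by ring
  rw [this]
  have h : (0 : ℝ) ≤ j := by positivity
  have h3 : (0 : ℝ) < 3 ^ (r + 1) * 3 ^ j := by positivity
  nlinarith

theorem logTail_summable (r : ℕ) :
    Summable fun j : ℕ => 1 / (((j : ℝ) + r + 1) * 3 ^ (j + r + 1)) :=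
  Summable.of_nonneg_of_le (fun j => by positivity) (logTail_term_le r)
    ((summable_geometric_of_lt_one (by norm_num) (by norm_num)).mul_left _)

theorem logTail_nonneg (r : ℕ) : 0 ≤ logTail r := tsum_nonneg fun j => by positivity

theorem logTail_le (r : ℕ) : logTail r ≤ 3 / 2 * (1 / (((r : ℝ) + 1) * 3 ^ (r + 1))) := by
  have hg := (hasSum_geometric_of_lt_one (r := (1 / 3 : ℝ)) (by norm_num) (by norm_num)).mul_left
    (1 / (((r : ℝ) + 1) * 3 ^ (r + 1)))
  have h := (logTail_summable r).tsum_le_tsum (logTail_term_le r) hg.summable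
  rw [hg.tsum_eq] at h
  refine h.trans (le_of_eq ?_)
  norm_num
  ring

theorem logTail_succ (r : ℕ) :
    logTail r = 1 / (((r : ℝ) + 1) * 3 ^ (r + 1)) + logTail (r + 1) := by
  rw [logTail, (logTail_summable r).tsum_eq_zero_add, logTail]
  congr 1
  · norm_num
  · refine tsum_congr fun j => ?_
    push_cast
    rw [show j + 1 + r + 1 = j + (r + 1) + 1 by ring,
      show (j : ℝ) + 1 + r + 1 = j + (r + 1) + 1 by ring]

theorem logTail_bounds : (4053 / 10000 : ℝ) ≤ logTail 0 ∧ logTail 0 ≤ 4056 / 10000 ∧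
    (720 / 10000 : ℝ) ≤ logTail 1 ∧ logTail 1 ≤ 723 / 10000 ∧
    (164 / 10000 : ℝ) ≤ logTail 2 ∧ logTail 2 ≤ 168 / 10000 := by
  have h0 := logTail_succ 0
  have h1 := logTail_succ 1
  have h2 := logTail_succ 2
  have h3 := logTail_succ 3
  have h4 := logTail_succ 4
  have h5 := logTail_succ 5
  have h6 := logTail_le 6
  have h7 := logTail_nonneg 6
  norm_num at h0 h1 h2 h3 h4 h5 h6 h7
  refine ⟨?_, ?_, ?_, ?_, ?_, ?_⟩ <;> linarith

theorem parkMatrix_col_zero (r : ℕ) :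
    parkMatrix (r + 2) 0 = (-1 : ℝ) ^ (r + 1) / ((r : ℝ) + 1) * logTail r := rfl

theorem parkMatrix_entry (r k : ℕ) : parkMatrix (r + 2) (k + 2) = ((k + 1).choose (r + 1) : ℝ)
    * ((-1 : ℝ) ^ (k + r) / 2 ^ (k + 2) - 1 / (((k : ℝ) + 1) * 2 ^ (k + 1))) := rfl

theorem parkMatrix_row_one (k : ℕ) : parkMatrix 1 (k + 2) =
    1 / ((k : ℝ) + 1) + (-1 : ℝ) ^ (k + 1) / 2 ^ (k + 2)
      - 1 / (((k : ℝ) + 1) * 2 ^ (k + 1)) := rfl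

theorem abs_parkMatrix_col_zero (r : ℕ) :
    |parkMatrix (r + 2) 0| = logTail r / ((r : ℝ) + 1) := by
  rw [parkMatrix_col_zero, abs_mul, abs_div, abs_pow, abs_neg, abs_one, one_pow,
    abs_of_nonneg (logTail_nonneg r), abs_of_pos (by positivity : (0 : ℝ) < (r : ℝ) + 1)]
  ring

theorem tsum_col_zero_tail_le (s : ℕ) : ∑' r, |parkMatrix (r + s + 2) 0| ≤
    9 / 4 * (1 / (((s : ℝ) + 1) ^ 2 * 3 ^ (s + 1))) := by
  have hterm : ∀ r : ℕ, |parkMatrix (r + s + 2) 0| ≤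
      3 / 2 * (1 / (((s : ℝ) + 1) ^ 2 * 3 ^ (s + 1))) * (1 / 3 : ℝ) ^ r := by
    intro r
    rw [abs_parkMatrix_col_zero]
    have h := logTail_le (r + s)
    rw [div_le_iff₀ (by positivity)]
    refine h.trans ?_
    push_cast
    have e : (3 : ℝ) ^ (r + s + 1) = 3 ^ (s + 1) * 3 ^ r := by ring
    rw [e, one_div_pow]
    have hr : (0 : ℝ) ≤ r := by positivity
    have hs : (0 : ℝ) ≤ s := by positivity
    have hE : (3 : ℝ) / 2 * (1 / (((s : ℝ) + 1) ^ 2 * 3 ^ (s + 1))) * (1 / 3 ^ r) * (r + s + 1)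
        = 3 / 2 * (1 / (3 ^ (s + 1) * 3 ^ r)) * ((r + s + 1) / ((s : ℝ) + 1) ^ 2) := by
      field_simp
    have hE' : (3 : ℝ) / 2 * (1 / (((r : ℝ) + s + 1) * (3 ^ (s + 1) * 3 ^ r)))
        = 3 / 2 * (1 / (3 ^ (s + 1) * 3 ^ r)) * (1 / ((r : ℝ) + s + 1)) := by
      field_simp
    rw [hE, hE']
    apply mul_le_mul_of_nonneg_left _ (by positivity)
    rw [div_le_div_iff₀ (by positivity) (by positivity)]
    nlinarith
  have hg := (hasSum_geometric_of_lt_one (r := (1 / 3 : ℝ)) (by norm_num) (by norm_num)).mul_left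
    (3 / 2 * (1 / (((s : ℝ) + 1) ^ 2 * 3 ^ (s + 1))))
  have hs : Summable fun r => |parkMatrix (r + s + 2) 0| :=
    Summable.of_nonneg_of_le (fun _ => abs_nonneg _) hterm hg.summable
  have h := hs.tsum_le_tsum hterm hg.summable
  rw [hg.tsum_eq] at h
  refine h.trans (le_of_eq ?_)
  norm_num
  ring

theorem dilog_neg_half_bounds :
    (-44850 / 100000 : ℝ) ≤ ∑' k : ℕ, (-1 : ℝ) ^ (k + 1) / (((k : ℝ) + 1) ^ 2 * 2 ^ (k + 1)) ∧
    ∑' k : ℕ, (-1 : ℝ) ^ (k + 1) / (((k : ℝ) + 1) ^ 2 * 2 ^ (k + 1)) ≤ -44834 / 100000 := by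
  have hb : ∀ k : ℕ, ‖(-1 : ℝ) ^ (k + 9) / (((k : ℝ) + 9) ^ 2 * 2 ^ (k + 9))‖ ≤
      -- `41472 = 9 ^ 2 * 2 ^ 9` is the denominator of the first term left after eight explicit
      -- ones.
      1 / 41472 * (1 / 2 : ℝ) ^ k := by
    intro k
    rw [norm_div, norm_pow, norm_neg, norm_one, one_pow, Real.norm_eq_abs,
      abs_of_pos (by positivity), one_div_pow, one_div_mul_one_div]
    apply one_div_le_one_div_of_le (by positivity)
    have hk : (0 : ℝ) ≤ k := by positivity
    have h2 : (0 : ℝ) < 2 ^ k := by positivity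
    rw [pow_add]
    nlinarith [mul_nonneg hk h2.le, mul_nonneg (mul_nonneg hk hk) h2.le]
  have hg := (hasSum_geometric_of_lt_one (r := (1 / 2 : ℝ)) (by norm_num) (by norm_num)).mul_left
    (1 / 41472)
  have ht := tsum_of_norm_bounded hg hb
  have hs : Summable fun k : ℕ => (-1 : ℝ) ^ (k + 1) / (((k : ℝ) + 1) ^ 2 * 2 ^ (k + 1)) := by
    rw [← summable_nat_add_iff 8]
    refine Summable.of_norm_bounded hg.summable fun k => ?_
    have e : ((k + 8 : ℕ) : ℝ) + 1 = k + 9 := by push_cast; ring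
    rw [e]
    exact hb k
  rw [← hs.sum_add_tsum_nat_add 8]
  have e : ∑' k : ℕ, (-1 : ℝ) ^ (k + 8 + 1) / ((((k + 8 : ℕ) : ℝ) + 1) ^ 2 * 2 ^ (k + 8 + 1)) =
      ∑' k : ℕ, (-1 : ℝ) ^ (k + 9) / (((k : ℝ) + 9) ^ 2 * 2 ^ (k + 9)) := by
    refine tsum_congr fun k => ?_
    push_cast
    ring
  rw [e]
  rw [Real.norm_eq_abs, abs_le] at ht
  simp only [Finset.sum_range_succ, Finset.sum_range_zero]
  norm_num at ht ⊢
  constructor <;> linarith [ht.1, ht.2]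

theorem parkMatrix_one_zero_bounds :
    (273 / 10000 : ℝ) ≤ parkMatrix 1 0 ∧ parkMatrix 1 0 ≤ 276 / 10000 := by
  have h := dilog_neg_half_bounds
  have e : parkMatrix 1 0 = Real.pi ^ 2 / 12
      + (∑' k : ℕ, (-1 : ℝ) ^ (k + 1) / (((k : ℝ) + 1) ^ 2 * 2 ^ (k + 1))) - Real.log 2 / 2 := rfl
  rw [e]
  have h1 := Real.log_two_gt_d9
  have h2 := Real.log_two_lt_d9
  have h3 := Real.pi_gt_d4
  have h4 := Real.pi_lt_d4
  constructor <;> nlinarith [h.1, h.2]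

/-- With `n = k + 2 ≥ 2`, `1 / (n 2ⁿ) ≤ 1 / 2ⁿ⁺¹`, so the alternating term decides the sign of every
entry. The absolute values then sum through the plain and the alternating binomial sums. -/
theorem tsum_parkMatrix_tail (k : ℕ) : ∑' i, |parkMatrix (i + 2) (k + 3)| =
    1 / 2 - (1 / 2 ^ (k + 3) - (-1 : ℝ) ^ k / (((k : ℝ) + 2) * 2 ^ (k + 2))) := by
  rw [tsum_eq_sum (s := Finset.range (k + 2)) (fun r hr => by
      have : (k + 2).choose (r + 1) = 0 := Nat.choose_eq_zero_of_lt (by simp at hr; omega)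
      rw [parkMatrix_entry r (k + 1), this]; simp)]
  have hterm : ∀ r ∈ Finset.range (k + 2), |parkMatrix (r + 2) (k + 3)| =
      ((k + 2).choose (r + 1) : ℝ) * (1 / 2 ^ (k + 3))
        - (-1 : ℝ) ^ k * (1 / (((k : ℝ) + 2) * 2 ^ (k + 2))) *
          ((-1 : ℝ) ^ (r + 1) * ((k + 2).choose (r + 1) : ℝ)) := by
    intro r _
    rw [parkMatrix_entry r (k + 1), abs_mul, abs_of_nonneg (by positivity)]
    have hle : 1 / (((k : ℝ) + 2) * 2 ^ (k + 2)) ≤ 1 / 2 ^ (k + 3) := by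
      apply one_div_le_one_div_of_le (by positivity)
      rw [pow_succ _ (k + 2)]
      have hk : (0 : ℝ) ≤ k := by positivity
      have h2 : (0 : ℝ) < 2 ^ (k + 2) := by positivity
      nlinarith
    push_cast
    rw [show (k : ℝ) + 1 + 1 = k + 2 by ring, show k + 1 + 1 = k + 2 by ring,
      show k + 1 + 2 = k + 3 by ring]
    have hpos : 0 ≤ 1 / (((k : ℝ) + 2) * 2 ^ (k + 2)) := by positivity
    have hs : (-1 : ℝ) ^ (k + 1 + r) = (-1) ^ k * (-1) ^ (r + 1) := by ring
    rw [hs]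
    rcases neg_one_pow_eq_or ℝ k with h | h <;> rcases neg_one_pow_eq_or ℝ (r + 1) with h' | h' <;>
      rw [h, h']
    · rw [abs_of_nonneg (by linarith)]; ring
    · rw [abs_of_nonpos (by
        have : (1 : ℝ) * -1 / 2 ^ (k + 3) = -(1 / 2 ^ (k + 3)) := by ring
        linarith)]; ring
    · rw [abs_of_nonpos (by
        have : (-1 : ℝ) * 1 / 2 ^ (k + 3) = -(1 / 2 ^ (k + 3)) := by ring
        linarith)]; ring
    · rw [abs_of_nonneg (by linarith)]; ring
  rw [Finset.sum_congr rfl hterm, Finset.sum_sub_distrib, ← Finset.sum_mul, ← Finset.mul_sum]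
  have h1 : ∑ r ∈ Finset.range (k + 2), ((k + 2).choose (r + 1) : ℝ) = 2 ^ (k + 2) - 1 := by
    have h := Nat.sum_range_choose (k + 2)
    rw [Finset.sum_range_succ'] at h
    have h' : ((∑ r ∈ Finset.range (k + 2), (k + 2).choose (r + 1) + (k + 2).choose 0 : ℕ) : ℝ)
        = ((2 ^ (k + 2) : ℕ) : ℝ) := by rw [h]
    push_cast at h'
    simp at h'
    linarith
  have h2 : ∑ r ∈ Finset.range (k + 2), (-1 : ℝ) ^ (r + 1) * ((k + 2).choose (r + 1) : ℝ) = -1 := by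
    have h := Int.alternating_sum_range_choose_of_ne (n := k + 2) (by omega)
    rw [Finset.sum_range_succ'] at h
    have h' : ((∑ r ∈ Finset.range (k + 2), (-1 : ℤ) ^ (r + 1) * ((k + 2).choose (r + 1) : ℤ)
        + (-1) ^ 0 * ((k + 2).choose 0 : ℤ) : ℤ) : ℝ) = ((0 : ℤ) : ℝ) := by rw [h]
    push_cast at h'
    simp at h'
    linarith
  rw [h1, h2, pow_succ _ (k + 2)]
  field_simp
  ring

/-- The second inequality feeds the induction through Pascal's rule; the first is an equality at `n
= 5`. -/
theorem choose_two_le {n : ℕ} (hn : 5 ≤ n) : 32 * n.choose 2 ≤ 10 * 2 ^ n ∧ 32 * n ≤ 10 * 2 ^ n := by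
  induction n, hn using Nat.le_induction with
  | base => decide
  | succ n hn ih =>
    rw [Nat.choose_succ_succ' n 1, Nat.choose_one_right, one_add_one_eq_two, pow_succ]
    omega

/-- The seminorm `‖x‖ + (2/5) |x₃|`. -/
noncomputable def parkSeminorm : Seminorm ℝ EllOne :=
  normSeminorm ℝ EllOne +
    (2 / 5 : NNReal) • (normSeminorm ℝ ℝ).comp (lp.evalCLM ℝ (fun _ : ℕ => ℝ) 1 3).toLinearMap

theorem parkSeminorm_apply (x : EllOne) : parkSeminorm x = ‖x‖ + 2 / 5 * |x 3| := by
  change ‖x‖ + (((2 / 5 : NNReal) : ℝ)) * |x 3| = _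
  norm_num

theorem abs_apply_le_norm (x : EllOne) (i : ℕ) : |x i| ≤ ‖x‖ := by
  rw [ellOne_norm]
  exact (ellOne_summable x).le_tsum i fun _ _ => abs_nonneg _

theorem ellOne_norm_split (x : EllOne) (n : ℕ) :
    ‖x‖ = ∑ i ∈ Finset.range n, |x i| + ∑' i, |x (i + n)| := by
  rw [ellOne_norm, (ellOne_summable x).sum_add_tsum_nat_add n]

theorem parkCol_apply (i j : ℕ) : parkCol j i = parkMatrix i j := rfl

theorem parkCol_norm_split (j n : ℕ) :
    ‖parkCol j‖ = ∑ i ∈ Finset.range n, |parkMatrix i j| + ∑' i, |parkMatrix (i + n) j| :=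
  ellOne_norm_split (parkCol j) n

theorem parkCol_norm_tail (k : ℕ) :
    ‖parkCol (k + 2)‖ = |parkMatrix 1 (k + 2)| + ∑' i, |parkMatrix (i + 2) (k + 2)| := by
  rw [parkCol_norm_split (k + 2) 2, Finset.sum_range_succ, Finset.sum_range_one]
  have : parkMatrix 0 (k + 2) = 0 := rfl
  rw [this, abs_zero, zero_add]

theorem parkCol_bound_generic (k : ℕ) :
    ‖parkCol (k + 6)‖ + 9 / 10 * |parkMatrix 1 (k + 6)| + 2 / 5 * |parkMatrix 3 (k + 6)|
      ≤ 21 / 20 := by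
  rw [parkCol_norm_tail (k + 4), tsum_parkMatrix_tail (k + 3)]
  have hk : (0 : ℝ) ≤ k := by positivity
  have h2 : (32 : ℝ) ≤ 2 ^ (k + 5) := by
    have : (2 : ℝ) ^ 5 ≤ 2 ^ (k + 5) := pow_le_pow_right₀ (by norm_num) (by omega)
    linarith
  have hsgn : |(-1 : ℝ) ^ (k + 3) / (((k + 3 : ℕ) + 2 : ℝ) * 2 ^ (k + 3 + 2))|
      ≤ 1 / 2 ^ (k + 6) := by
    rw [abs_div, abs_pow, abs_neg, abs_one, one_pow, abs_of_pos (by positivity)]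
    apply one_div_le_one_div_of_le (by positivity)
    rw [show k + 3 + 2 = k + 5 by ring, pow_succ _ (k + 5)]
    push_cast
    nlinarith
  have htail := (abs_le.1 hsgn).2
  have h1 : |parkMatrix 1 (k + 6)| ≤ 1 / 5 + 1 / 64 := by
    rw [parkMatrix_row_one (k + 4)]
    have ha : |(-1 : ℝ) ^ (k + 4 + 1) / 2 ^ (k + 4 + 2)| ≤ 1 / 64 := by
      rw [abs_div, abs_pow, abs_neg, abs_one, one_pow, abs_of_pos (by positivity)]
      apply one_div_le_one_div_of_le (by positivity)
      rw [show k + 4 + 2 = k + 5 + 1 by ring, pow_succ]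
      linarith
    have ha' := abs_le.1 ha
    have hb : 1 / (((k + 4 : ℕ) : ℝ) + 1) ≤ 1 / 5 := by
      apply one_div_le_one_div_of_le (by positivity)
      push_cast
      linarith
    have hc : 1 / ((((k + 4 : ℕ) : ℝ) + 1) * 2 ^ (k + 4 + 1)) ≤ 1 / (((k + 4 : ℕ) : ℝ) + 1) := by
      apply one_div_le_one_div_of_le (by positivity)
      rw [show k + 4 + 1 = k + 5 by ring]
      have : (0 : ℝ) ≤ ((k + 4 : ℕ) : ℝ) + 1 := by positivity
      nlinarith
    have hd : 0 ≤ 1 / ((((k + 4 : ℕ) : ℝ) + 1) * 2 ^ (k + 4 + 1)) := by positivity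
    rw [abs_le]
    constructor <;> linarith [ha'.1, ha'.2]
  have h3 : |parkMatrix 3 (k + 6)| ≤ 7 / 32 := by
    rw [parkMatrix_entry 1 (k + 4), abs_mul, abs_of_nonneg (by positivity)]
    have hch : ((k + 5).choose 2 : ℝ) ≤ 10 / 32 * 2 ^ (k + 5) := by
      have h := (choose_two_le (n := k + 5) (by omega)).1
      have h' : ((32 * (k + 5).choose 2 : ℕ) : ℝ) ≤ ((10 * 2 ^ (k + 5) : ℕ) : ℝ) := by
        exact_mod_cast h
      push_cast at h'
      linarith
    have ha : |(-1 : ℝ) ^ (k + 4 + 1) / 2 ^ (k + 4 + 2)| ≤ 1 / 2 * (1 / 2 ^ (k + 5)) := by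
      rw [abs_div, abs_pow, abs_neg, abs_one, one_pow, abs_of_pos (by positivity)]
      refine le_of_eq ?_
      rw [show k + 4 + 2 = k + 5 + 1 by ring, pow_succ]
      field_simp
    have hb : 1 / ((((k + 4 : ℕ) : ℝ) + 1) * 2 ^ (k + 4 + 1)) ≤ 1 / 5 * (1 / 2 ^ (k + 5)) := by
      rw [one_div_mul_one_div]
      apply one_div_le_one_div_of_le (by positivity)
      rw [show k + 4 + 1 = k + 5 by ring]
      push_cast
      nlinarith
    have hd : 0 ≤ 1 / ((((k + 4 : ℕ) : ℝ) + 1) * 2 ^ (k + 4 + 1)) := by positivity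
    have habs : |(-1 : ℝ) ^ (k + 4 + 1) / 2 ^ (k + 4 + 2)
        - 1 / ((((k + 4 : ℕ) : ℝ) + 1) * 2 ^ (k + 4 + 1))| ≤ 7 / 10 * (1 / 2 ^ (k + 5)) := by
      refine (abs_sub _ _).trans ?_
      rw [abs_of_nonneg hd]
      linarith
    calc ((k + 5).choose 2 : ℝ) * |(-1 : ℝ) ^ (k + 4 + 1) / 2 ^ (k + 4 + 2)
        - 1 / ((((k + 4 : ℕ) : ℝ) + 1) * 2 ^ (k + 4 + 1))|
        ≤ 10 / 32 * 2 ^ (k + 5) * (7 / 10 * (1 / 2 ^ (k + 5))) := by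
          gcongr
      _ = 10 / 32 * (7 / 10) * (2 ^ (k + 5) * (1 / 2 ^ (k + 5))) := by ring
      _ = 7 / 32 := by rw [mul_one_div_cancel (by positivity)]; norm_num
  have e : k + 4 + 2 = k + 6 := rfl
  have e' : k + 3 + 3 = k + 6 := rfl
  rw [e, e']
  linarith

theorem parkMatrix_one_two : parkMatrix 1 2 = 1 / 4 := by
  rw [parkMatrix_row_one 0]; norm_num

theorem parkMatrix_one_three : parkMatrix 1 3 = 1 / 2 := by
  rw [parkMatrix_row_one 1]; norm_num

theorem parkMatrix_one_four : parkMatrix 1 4 = 11 / 48 := by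
  rw [parkMatrix_row_one 2]; norm_num

theorem parkMatrix_one_five : parkMatrix 1 5 = 17 / 64 := by
  rw [parkMatrix_row_one 3]; norm_num

theorem parkMatrix_two_two : parkMatrix 2 2 = -1 / 4 := by
  rw [parkMatrix_entry 0 0]; norm_num

theorem parkMatrix_add_three_two (r : ℕ) : parkMatrix (r + 3) 2 = 0 := by
  rw [parkMatrix_entry (r + 1) 0, Nat.choose_eq_zero_of_lt (by omega)]; simp

theorem parkMatrix_two_three : parkMatrix 2 3 = -1 / 2 := by
  rw [parkMatrix_entry 0 1]; norm_num

theorem parkMatrix_add_three_three (r : ℕ) : parkMatrix (r + 3) 3 = 0 := by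
  rw [parkMatrix_entry (r + 1) 1]
  rcases r with _ | r
  · norm_num
  · rw [Nat.choose_eq_zero_of_lt (by omega)]; simp

theorem parkMatrix_two_four : parkMatrix 2 4 = 1 / 16 := by
  rw [parkMatrix_entry 0 2]; norm_num

theorem parkMatrix_three_four : parkMatrix 3 4 = -5 / 16 := by
  rw [parkMatrix_entry 1 2, show Nat.choose (2 + 1) (1 + 1) = 3 from rfl]; norm_num

theorem parkMatrix_four_four : parkMatrix 4 4 = 1 / 48 := by
  rw [parkMatrix_entry 2 2]; norm_num

theorem parkMatrix_add_five_four (r : ℕ) : parkMatrix (r + 5) 4 = 0 := by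
  rw [parkMatrix_entry (r + 3) 2, Nat.choose_eq_zero_of_lt (by omega)]; simp

theorem parkMatrix_three_five : parkMatrix 3 5 = 3 / 32 := by
  rw [parkMatrix_entry 1 3, show Nat.choose (3 + 1) (1 + 1) = 6 from rfl]; norm_num

theorem parkMatrix_three_zero : parkMatrix 3 0 = logTail 1 / 2 := by
  rw [parkMatrix_col_zero 1]; norm_num; ring

theorem parkMatrix_two_zero : parkMatrix 2 0 = -logTail 0 := by
  rw [parkMatrix_col_zero 0]; norm_num

theorem parkMatrix_four_zero : parkMatrix 4 0 = -logTail 2 / 3 := by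
  rw [parkMatrix_col_zero 2]; norm_num; ring

theorem parkMatrix_zero_zero : parkMatrix 0 0 = 1 / 2 := rfl

theorem parkMatrix_zero_one : parkMatrix 0 1 = -1 := rfl

theorem parkMatrix_zero_add_two (k : ℕ) : parkMatrix 0 (k + 2) = 0 := rfl

theorem parkMatrix_one_one : parkMatrix 1 1 = 1 / 2 + Real.log 2 := rfl

theorem parkMatrix_add_two_one (r : ℕ) : parkMatrix (r + 2) 1 = 0 := rfl

theorem parkCol_bound_zero :
    ‖parkCol 0‖ + 9 / 10 * |parkMatrix 1 0| + 2 / 5 * |parkMatrix 3 0| ≤ 21 / 20 := by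
  have h := tsum_col_zero_tail_le 2
  rw [parkCol_norm_split 0 4]
  simp only [Finset.sum_range_succ, Finset.sum_range_zero, parkMatrix_zero_zero,
    abs_parkMatrix_col_zero 0, abs_parkMatrix_col_zero 1]
  rw [abs_of_nonneg (by linarith [parkMatrix_one_zero_bounds.1] : 0 ≤ parkMatrix 1 0)]
  obtain ⟨-, h0, -, h1, -, -⟩ := logTail_bounds
  have hb := parkMatrix_one_zero_bounds.2
  norm_num at h ⊢
  linarith

/-- Column 3 motivates the weight `2/5`: its left side is `1.45`, too large for `21/20` but below
`21/20 * 7/5 = 1.47`. The other columns have room for the extra cost of row 3. -/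
theorem parkCol_bound {j : ℕ} (hj : j ≠ 1) :
    ‖parkCol j‖ + 9 / 10 * |parkMatrix 1 j| + 2 / 5 * |parkMatrix 3 j|
      ≤ 21 / 20 * (1 + 2 / 5 * if j = 3 then 1 else 0) := by
  match j with
  | 0 => simpa using parkCol_bound_zero
  | 1 => exact absurd rfl hj
  | 2 =>
    have h : ∑' i, |parkMatrix (i + 3) 2| = 0 := by simp [parkMatrix_add_three_two]
    have h0 : parkMatrix 0 2 = 0 := rfl
    rw [parkCol_norm_split 2 3, h, parkMatrix_add_three_two 0]
    simp only [Finset.sum_range_succ, Finset.sum_range_zero, h0, parkMatrix_one_two,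
      parkMatrix_two_two]
    norm_num [abs_of_pos, abs_of_neg]
  | 3 =>
    rw [parkCol_norm_tail 1, tsum_parkMatrix_tail 0, parkMatrix_one_three,
      parkMatrix_add_three_three 0]
    norm_num [abs_of_pos, abs_of_neg]
  | 4 =>
    rw [parkCol_norm_tail 2, tsum_parkMatrix_tail 1, parkMatrix_one_four, parkMatrix_three_four]
    norm_num [abs_of_pos, abs_of_neg]
  | 5 =>
    rw [parkCol_norm_tail 3, tsum_parkMatrix_tail 2, parkMatrix_one_five, parkMatrix_three_five]
    norm_num [abs_of_pos, abs_of_neg]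
  | k + 6 => simpa using parkCol_bound_generic k

/-- On a weighted ℓ¹ space it suffices to bound columns; `k 1 = 0` removes the one column not
covered by `parkCol_bound`. -/
theorem parkOp_contr {k : EllOne} (hk : k 1 = 0) :
    ‖parkOp k‖ + 9 / 10 * |parkOp k 1| + 2 / 5 * |parkOp k 3| ≤ 21 / 20 * parkSeminorm k := by
  have hn : Summable fun j => ‖k j • parkCol j‖ := summable_norm_smul_parkCol k
  have h0 : ‖parkOp k‖ ≤ ∑' j, ‖k j • parkCol j‖ := norm_tsum_le_tsum_norm hn
  have hs : ∀ i, Summable fun j => ‖parkMatrix i j * k j‖ := fun i =>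
    Summable.of_nonneg_of_le (fun _ => norm_nonneg _) (fun j => by
      rw [norm_smul, norm_mul, mul_comm]
      exact mul_le_mul_of_nonneg_left (abs_apply_le_norm (parkCol j) i) (norm_nonneg _)) hn
  have hi : ∀ i, |parkOp k i| ≤ ∑' j, ‖parkMatrix i j * k j‖ := by
    intro i
    rw [← (parkOp_hasSum k i).tsum_eq]
    exact norm_tsum_le_tsum_norm (hs i)
  have hsum := (hn.add ((hs 1).mul_left (9 / 10))).add ((hs 3).mul_left (2 / 5))
  have hrhs : HasSum (fun j => 21 / 20 * (|k j| + 2 / 5 * if j = 3 then |k j| else 0))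
      (21 / 20 * parkSeminorm k) := by
    rw [parkSeminorm_apply, ellOne_norm]
    refine ((ellOne_summable k).hasSum.add (HasSum.mul_left _ ?_)).mul_left _
    have h := hasSum_single (f := fun j => if j = 3 then |k j| else 0) 3
      fun j hj => if_neg hj
    simpa using h
  calc _ ≤ ∑' j, ‖k j • parkCol j‖ + 9 / 10 * ∑' j, ‖parkMatrix 1 j * k j‖
        + 2 / 5 * ∑' j, ‖parkMatrix 3 j * k j‖ := by
        gcongr
        · exact hi 1
        · exact hi 3
    _ = ∑' j, (‖k j • parkCol j‖ + 9 / 10 * ‖parkMatrix 1 j * k j‖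
        + 2 / 5 * ‖parkMatrix 3 j * k j‖) := by
        rw [(hn.add ((hs 1).mul_left (9 / 10))).tsum_add ((hs 3).mul_left (2 / 5)),
          hn.tsum_add ((hs 1).mul_left (9 / 10)), tsum_mul_left, tsum_mul_left]
    _ ≤ _ := by
        rw [← hrhs.tsum_eq]
        refine hsum.tsum_le_tsum (fun j => ?_) hrhs.summable
        rcases eq_or_ne j 1 with rfl | hj
        · simp [hk]
        · have h := mul_le_mul_of_nonneg_left (parkCol_bound hj) (abs_nonneg (k j))
          simp only [norm_smul, norm_mul, Real.norm_eq_abs]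
          split_ifs at h ⊢ <;> linarith

/-! ### Truncations, the approximate eigenvector and the cone. -/

/-- Truncation of a sequence to the indices `0, …, m`. -/
noncomputable def trunc (m : ℕ) : EllOne →L[ℝ] EllOne :=
  ∑ i ∈ Finset.range (m + 1), (lp.singleContinuousLinearMap ℝ (fun _ : ℕ => ℝ) 1 i).comp
    (lp.evalCLM ℝ (fun _ : ℕ => ℝ) 1 i)

theorem trunc_eq_sum (m : ℕ) (x : EllOne) :
    trunc m x = ∑ i ∈ Finset.range (m + 1), lp.single 1 i (x i) := by
  simp only [trunc, sum_apply]
  rfl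

theorem trunc_apply (m : ℕ) (x : EllOne) (i : ℕ) : trunc m x i = if i ≤ m then x i else 0 := by
  rw [trunc_eq_sum, lp.coeFn_sum, Finset.sum_apply]
  split_ifs with h
  · rw [Finset.sum_eq_single i]
    · exact lp.single_apply_self 1 i _
    · intro j _ hj
      exact lp.single_apply_ne 1 j _ hj.symm
    · intro hi
      simp at hi
      omega
  · refine Finset.sum_eq_zero fun j hj => lp.single_apply_ne 1 j _ ?_
    simp at hj
    omega

theorem norm_trunc_le (m : ℕ) (x : EllOne) : ‖trunc m x‖ ≤ ‖x‖ := by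
  rw [ellOne_norm, ellOne_norm]
  refine (ellOne_summable _).tsum_le_tsum (fun i => ?_) (ellOne_summable x)
  rw [trunc_apply]
  split_ifs
  · rfl
  · simp

theorem abs_trunc_le (m : ℕ) (x : EllOne) (i : ℕ) : |trunc m x i| ≤ |x i| := by
  rw [trunc_apply]
  split_ifs
  · rfl
  · simp

theorem parkSeminorm_trunc_le (m : ℕ) (x : EllOne) : parkSeminorm (trunc m x) ≤ parkSeminorm x := by
  rw [parkSeminorm_apply, parkSeminorm_apply]
  linarith [norm_trunc_le m x, abs_trunc_le m x 3]

theorem tendsto_trunc (x : EllOne) : Tendsto (fun m => trunc m x) atTop (𝓝 x) := by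
  have h := (lp.hasSum_single (p := 1) (by simp) x).tendsto_sum_nat
  refine (h.comp (tendsto_add_atTop_nat 1)).congr fun m => ?_
  rw [trunc_eq_sum]
  rfl

/-- The compression of the operator to the first `m + 1` coordinates. -/
noncomputable def parkTrunc (m : ℕ) : EllOne →L[ℝ] EllOne := (trunc m).comp (parkOp.comp (trunc m))

theorem parkTrunc_apply (m : ℕ) (x : EllOne) : parkTrunc m x = trunc m (parkOp (trunc m x)) := rfl

/-- An approximate eigenvector, normalized by its entry of index `1`. -/
noncomputable def approxEigen : EllOne :=
  lp.single 1 0 (-15 / 11) + lp.single 1 1 1 + lp.single 1 2 (97 / 250) +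
    lp.single 1 3 (-21 / 500) + lp.single 1 4 (13 / 2000)

theorem approxEigen_zero : approxEigen 0 = -15 / 11 := by
  simp [approxEigen, lp.single_apply]

theorem approxEigen_one : approxEigen 1 = 1 := by
  simp [approxEigen, lp.single_apply]

theorem approxEigen_two : approxEigen 2 = 97 / 250 := by
  simp [approxEigen, lp.single_apply]

theorem approxEigen_three : approxEigen 3 = -21 / 500 := by
  simp [approxEigen, lp.single_apply]

theorem approxEigen_four : approxEigen 4 = 13 / 2000 := by
  simp [approxEigen, lp.single_apply]

theorem approxEigen_add_five (i : ℕ) : approxEigen (i + 5) = 0 := by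
  simp [approxEigen, lp.single_apply]

theorem parkOp_approxEigen (i : ℕ) : parkOp approxEigen i =
    parkMatrix i 0 * (-15 / 11) + parkMatrix i 1 + parkMatrix i 2 * (97 / 250)
      + parkMatrix i 3 * (-21 / 500) + parkMatrix i 4 * (13 / 2000) := by
  rw [← (parkOp_hasSum approxEigen i).tsum_eq, tsum_eq_sum (s := Finset.range 5)]
  · simp only [Finset.sum_range_succ, Finset.sum_range_zero, approxEigen_zero, approxEigen_one,
      approxEigen_two, approxEigen_three, approxEigen_four]
    ring
  · intro j hj
    obtain ⟨n, rfl⟩ : ∃ n, j = n + 5 := ⟨j - 5, by simp at hj; omega⟩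
    rw [approxEigen_add_five, mul_zero]

theorem parkOp_approxEigen_one_bounds :
    (1233 / 1000 : ℝ) ≤ parkOp approxEigen 1 ∧ parkOp approxEigen 1 ≤ 12335 / 10000 := by
  rw [parkOp_approxEigen, parkMatrix_one_one, parkMatrix_one_two, parkMatrix_one_three,
    parkMatrix_one_four]
  have h := parkMatrix_one_zero_bounds
  have h1 := Real.log_two_gt_d9
  have h2 := Real.log_two_lt_d9
  constructor <;> linarith [h.1, h.2]

theorem approxEigen_residual :
    parkSeminorm (parkOp approxEigen - parkOp approxEigen 1 • approxEigen) ≤ 6 / 1000 := by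
  obtain ⟨ha1, ha2⟩ := parkOp_approxEigen_one_bounds
  set a := parkOp approxEigen 1 with ha
  obtain ⟨h0, h0', h1, h1', h2, h2'⟩ := logTail_bounds
  set R := parkOp approxEigen - a • approxEigen with hR
  have hRi : ∀ i, R i = parkOp approxEigen i - a * approxEigen i := fun i => rfl
  -- From row 5 on, only column 0 contributes; `1296 = 4 ^ 2 * 3 ^ 4`.
  have htail : ∑' i, |R (i + 5)| ≤ 15 / 11 * (9 / 4 * (1 / 1296)) := by
    have e : ∀ i, |R (i + 5)| = 15 / 11 * |parkMatrix (i + 3 + 2) 0| := by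
      intro i
      rw [hRi, approxEigen_add_five, parkOp_approxEigen, parkMatrix_add_two_one (i + 3),
        parkMatrix_add_three_two (i + 2), parkMatrix_add_three_three (i + 2),
        parkMatrix_add_five_four]
      simp only [zero_mul, mul_zero, add_zero, sub_zero, abs_mul]
      norm_num [abs_of_neg]
      ring
    simp_rw [e]
    rw [tsum_mul_left]
    gcongr
    refine (tsum_col_zero_tail_le 3).trans (le_of_eq ?_)
    norm_num
  -- The entry `-15/11` solves row 0 exactly for the eigenvalue `37/30`, which lies between the
  -- bounds for `a`.
  have r0 : |R 0| ≤ 5 / 10000 := by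
    rw [hRi, approxEigen_zero, parkOp_approxEigen, parkMatrix_zero_zero, parkMatrix_zero_one,
      parkMatrix_zero_add_two 0, parkMatrix_zero_add_two 1, parkMatrix_zero_add_two 2, abs_le]
    constructor <;> linarith
  have r1 : R 1 = 0 := by rw [hRi, approxEigen_one, ← ha]; ring
  have r2 : |R 2| ≤ 16 / 10000 := by
    rw [hRi, approxEigen_two, parkOp_approxEigen, parkMatrix_two_zero, parkMatrix_add_two_one 0,
      parkMatrix_two_two, parkMatrix_two_three, parkMatrix_two_four, abs_le]
    constructor <;> linarith
  have r3 : |R 3| ≤ 7 / 10000 := by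
    rw [hRi, approxEigen_three, parkOp_approxEigen, parkMatrix_three_zero,
      parkMatrix_add_two_one 1, parkMatrix_add_three_two 0, parkMatrix_add_three_three 0,
      parkMatrix_three_four, abs_le]
    constructor <;> linarith
  have r4 : |R 4| ≤ 5 / 10000 := by
    rw [hRi, approxEigen_four, parkOp_approxEigen, parkMatrix_four_zero,
      parkMatrix_add_two_one 2, parkMatrix_add_three_two 1, parkMatrix_add_three_three 1,
      parkMatrix_four_four, abs_le]
    constructor <;> linarith
  rw [parkSeminorm_apply, ellOne_norm_split R 5]
  simp only [Finset.sum_range_succ, Finset.sum_range_zero, r1, abs_zero]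
  linarith

theorem approxEigen_sub_single :
    parkSeminorm (approxEigen - lp.single 1 1 1) ≤ 186 / 100 - 1 / 25 := by
  have hi : ∀ i, (approxEigen - lp.single 1 1 1 : EllOne) i
      = approxEigen i - (lp.single 1 1 (1 : ℝ) : EllOne) i := fun i => rfl
  have ht : ∀ i, (approxEigen - lp.single 1 1 1 : EllOne) (i + 5) = 0 := by
    intro i
    rw [hi, approxEigen_add_five, lp.single_apply_ne 1 1 _ (by omega), sub_zero]
  rw [parkSeminorm_apply, ellOne_norm_split _ 5]
  simp only [ht, Finset.sum_range_succ, Finset.sum_range_zero, hi, approxEigen_zero,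
    approxEigen_one, approxEigen_two, approxEigen_three, approxEigen_four]
  simp [lp.single_apply]
  norm_num [abs_of_pos, abs_of_neg]

/-- The cone around the approximate eigenvector. -/
noncomputable def parkFrame : ConeFrame EllOne where
  p := parkSeminorm
  φ := lp.evalCLM ℝ (fun _ : ℕ => ℝ) 1 1
  e := lp.single 1 1 1
  v₀ := approxEigen
  -- The value of `l` lies between `1/2 + log 2 ≈ 1.193`, needed for the sign of the left
  -- eigenvector at index 0, and the approximate eigenvalue `1.233`. Then `(l - q) δ = 0.006` is
  -- exactly the residual bound.
  S := 19 / 10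
  q := 21 / 20
  l := 6 / 5
  δ := 1 / 25
  C := 7 / 5
  norm_le x := by
    rw [parkSeminorm_apply]
    have := abs_nonneg (x 3)
    linarith
  le_norm x := by
    rw [parkSeminorm_apply]
    linarith [abs_apply_le_norm x 3]
  φ_e := lp.single_apply_self (E := fun _ : ℕ => ℝ) 1 1 1
  φ_v₀ := approxEigen_one
  q_pos := by norm_num
  q_lt_l := by norm_num
  S_pos := by norm_num
  δ_nonneg := by norm_num
  le_S := by linarith [approxEigen_sub_single]

theorem norm_sub_single_one (x : EllOne) : ‖x - x 1 • lp.single 1 1 1‖ = ‖x‖ - |x 1| := by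
  have hi : ∀ i, (x - x 1 • lp.single 1 1 1 : EllOne) i
      = x i - x 1 * (lp.single 1 1 (1 : ℝ) : EllOne) i := fun i => rfl
  have ht : ∀ i, (x - x 1 • lp.single 1 1 1 : EllOne) (i + 2) = x (i + 2) := by
    intro i
    rw [hi, lp.single_apply_ne 1 1 _ (by omega), mul_zero, sub_zero]
  have h1 : (x - x 1 • lp.single 1 1 1 : EllOne) 1 = 0 := by
    rw [hi, lp.single_apply_self, mul_one, sub_self]
  have h0 : (x - x 1 • lp.single 1 1 1 : EllOne) 0 = x 0 := by
    rw [hi, lp.single_apply_ne 1 1 _ (by omega), mul_zero, sub_zero]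
  rw [ellOne_norm_split _ 2, ellOne_norm_split x 2]
  simp only [ht, Finset.sum_range_succ, Finset.sum_range_zero, h1, h0, abs_zero]
  ring

/-- Compression along `e` removes `|x 1|` from the ℓ¹ norm, which leaves the coefficient `S - 1 =
9/10` used in the column estimates. -/
theorem parkSeminorm_sub_single_one (x : EllOne) :
    parkSeminorm (x - x 1 • lp.single 1 1 1) + 19 / 10 * |x 1|
      = ‖x‖ + 9 / 10 * |x 1| + 2 / 5 * |x 3| := by
  have h3 : (x - x 1 • lp.single 1 1 1 : EllOne) 3 = x 3 := by
    change x 3 - x 1 * (lp.single 1 1 (1 : ℝ) : EllOne) 3 = x 3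
    rw [lp.single_apply_ne 1 1 _ (by omega), mul_zero, sub_zero]
  rw [parkSeminorm_apply, norm_sub_single_one, h3]
  ring

theorem parkFrame_contracts_parkOp : parkFrame.Contracts parkOp where
  contr k hk := by
    refine le_trans (le_of_eq (parkSeminorm_sub_single_one (parkOp k))) (parkOp_contr hk)
  residual := by
    refine approxEigen_residual.trans ?_
    change (6 / 1000 : ℝ) ≤ (6 / 5 - 21 / 20) * (1 / 25)
    norm_num
  lower := by
    change (6 / 5 + 21 / 20 / (19 / 10) * (1 / 25) : ℝ) ≤ parkOp approxEigen 1
    refine le_trans ?_ parkOp_approxEigen_one_bounds.1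
    norm_num

theorem trunc_approxEigen {m : ℕ} (hm : 4 ≤ m) : trunc m approxEigen = approxEigen := by
  apply lp.ext
  funext i
  rw [trunc_apply]
  split_ifs with h
  · rfl
  · obtain ⟨n, rfl⟩ : ∃ n, i = n + 5 := ⟨i - 5, by omega⟩
    rw [approxEigen_add_five]

/-- Truncation decreases every absolute value in the estimates and, once `m ≥ 4`, fixes the
approximate eigenvector, so no constant changes. -/
theorem parkFrame_contracts_parkTrunc {m : ℕ} (hm : 4 ≤ m) :
    parkFrame.Contracts (parkTrunc m) where
  contr k hk := by
    have hk' : trunc m k 1 = 0 := by rw [trunc_apply, if_pos (by omega)]; exact hk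
    refine le_trans (le_of_eq (parkSeminorm_sub_single_one (parkTrunc m k))) ?_
    rw [parkTrunc_apply]
    refine le_trans ?_ ((parkOp_contr hk').trans
      (mul_le_mul_of_nonneg_left (parkSeminorm_trunc_le m k) (by norm_num)))
    linarith [norm_trunc_le m (parkOp (trunc m k)), abs_trunc_le m (parkOp (trunc m k)) 1,
      abs_trunc_le m (parkOp (trunc m k)) 3]
  residual := by
    have e : parkTrunc m approxEigen - (parkTrunc m approxEigen) 1 • approxEigen
        = trunc m (parkOp approxEigen - parkOp approxEigen 1 • approxEigen) := by
      rw [map_sub, map_smul, parkTrunc_apply, trunc_approxEigen hm, trunc_apply,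
        if_pos (by omega)]
    change parkSeminorm (parkTrunc m approxEigen - (parkTrunc m approxEigen) 1 • approxEigen) ≤ _
    rw [e]
    exact (parkSeminorm_trunc_le _ _).trans parkFrame_contracts_parkOp.residual
  lower := by
    refine parkFrame_contracts_parkOp.lower.trans (le_of_eq ?_)
    change parkOp approxEigen 1 = parkTrunc m approxEigen 1
    rw [parkTrunc_apply, trunc_approxEigen hm, trunc_apply, if_pos (by omega)]

theorem ConeFrame.Contracts.exists_principal {E : Type*} [NormedAddCommGroup E] [NormedSpace ℝ E]
    [CompleteSpace E] {F : ConeFrame E} {T : E →L[ℝ] E} (hT : F.Contracts T) :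
    ∃ (v : E) (μ : ℝ) (w : E →L[ℝ] ℝ), v ∈ F.base ∧ F.l ≤ μ ∧ T v = μ • v ∧
      (∀ x, w (T x) = μ * w x) ∧ w v = 1 ∧ 0 < w F.e ∧
      Tendsto (fun n : ℕ => (μ ^ n)⁻¹ • F.φ.comp (T ^ n)) atTop (𝓝 w) ∧
      ∀ x, Tendsto (fun n : ℕ => (μ ^ n)⁻¹ • (T ^ n) x) atTop (𝓝 (w x • v)) := by
  obtain ⟨v, hv, μ, hμ, hTv⟩ := hT.exists_eigenvector
  obtain ⟨w, hw, hwv, hlim, hlimx⟩ := hT.exists_left_eigen hv hTv hμ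
  exact ⟨v, μ, w, hv, hμ, hTv, hw, hwv, hT.left_eigen_e_pos hv hμ hw hwv, hlim, hlimx⟩

/-! ### Functionals on ℓ¹ as bounded sequences. -/

/-- The unit vectors of `ℓ¹`. -/
noncomputable def unitVec (i : ℕ) : EllOne := lp.single 1 i 1

theorem single_eq_smul_unitVec (i : ℕ) (a : ℝ) : lp.single 1 i a = a • unitVec i := by
  rw [unitVec, ← lp.single_smul, smul_eq_mul, mul_one]

theorem norm_unitVec (i : ℕ) : ‖unitVec i‖ = 1 := by
  rw [unitVec, lp.norm_single (by simp)]
  simp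

theorem hasSum_functional (w : EllOne →L[ℝ] ℝ) (u : EllOne) :
    HasSum (fun i => w (unitVec i) * u i) (w u) := by
  have h := (lp.hasSum_single (p := 1) (by simp) u).mapL w
  have e : (fun i => w (unitVec i) * u i) = fun i => w (lp.single 1 i (u i)) := by
    funext i
    rw [single_eq_smul_unitVec, map_smul, smul_eq_mul, mul_comm]
  rw [e]
  exact h

/-- The coordinates of a functional on `ℓ¹`, as a bounded sequence. -/
noncomputable def dualSeq : (EllOne →L[ℝ] ℝ) →L[ℝ] EllInf :=
  LinearMap.mkContinuous
    { toFun := fun w => ⟨fun i => w (unitVec i), memℓp_infty ⟨‖w‖, by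
        rintro _ ⟨i, rfl⟩
        simpa [norm_unitVec] using w.le_opNorm (unitVec i)⟩⟩
      map_add' := fun _ _ => rfl
      map_smul' := fun _ _ => rfl } 1 fun w => by
      refine lp.norm_le_of_forall_le (by positivity) fun i => ?_
      have h := w.le_opNorm (unitVec i)
      rw [norm_unitVec, mul_one] at h
      rw [one_mul]
      exact h

theorem dualSeq_apply (w : EllOne →L[ℝ] ℝ) (i : ℕ) : dualSeq w i = w (unitVec i) := rfl

theorem rowMul_dualSeq (w : EllOne →L[ℝ] ℝ) (u : EllOne) : rowMul (dualSeq w) u = w u :=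
  (hasSum_functional w u).tsum_eq

theorem parkOp_unitVec (j : ℕ) : parkOp (unitVec j) = parkCol j := by
  apply lp.ext
  funext i
  rw [← (parkOp_hasSum (unitVec j) i).tsum_eq, tsum_eq_single j, unitVec, lp.single_apply_self,
    mul_one, parkCol_apply]
  intro k hk
  rw [unitVec, lp.single_apply_ne 1 j _ hk, mul_zero]

/-! ### The left eigenvector lies in `c₀`. -/

section Vanishing

theorem tendsto_choose_div_two_pow (r : ℕ) :
    Tendsto (fun k : ℕ => (k.choose r : ℝ) / 2 ^ k) atTop (𝓝 0) := by
  refine squeeze_zero (fun k => by positivity) (fun k => ?_)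
    (tendsto_pow_const_div_const_pow_of_one_lt r (r := (2 : ℝ)) (by norm_num))
  gcongr
  exact_mod_cast Nat.choose_le_pow k r

theorem tendsto_parkMatrix_row (i : ℕ) :
    Tendsto (fun j => parkMatrix i j) atTop (𝓝 0) := by
  rw [← tendsto_add_atTop_iff_nat 2]
  -- The case `r = 0` is row 1 without its summand `1 / (k + 1)`; larger `r` give the lower rows.
  have hterm : ∀ r : ℕ, Tendsto (fun k : ℕ => ((k + 1).choose r : ℝ) *
      ((-1 : ℝ) ^ (k + r + 1) / 2 ^ (k + 2) - 1 / (((k : ℝ) + 1) * 2 ^ (k + 1)))) atTop (𝓝 0) := by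
    intro r
    have h := ((tendsto_choose_div_two_pow r).comp (tendsto_add_atTop_nat 1)).const_mul 2
    rw [mul_zero] at h
    refine squeeze_zero_norm (fun k => ?_) h
    have hk : (0 : ℝ) ≤ k := by positivity
    have h2 : (0 : ℝ) < 2 ^ (k + 1) := by positivity
    have ha : |(-1 : ℝ) ^ (k + r + 1) / 2 ^ (k + 2)| ≤ 1 / 2 ^ (k + 1) := by
      rw [abs_div, abs_pow, abs_neg, abs_one, one_pow, abs_of_pos (by positivity)]
      apply one_div_le_one_div_of_le (by positivity)
      rw [pow_succ _ (k + 1)]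
      linarith
    have hb : |1 / (((k : ℝ) + 1) * 2 ^ (k + 1))| ≤ 1 / 2 ^ (k + 1) := by
      rw [abs_of_pos (by positivity)]
      apply one_div_le_one_div_of_le (by positivity)
      nlinarith
    rw [norm_mul, Real.norm_eq_abs, Real.norm_eq_abs, abs_of_nonneg (by positivity)]
    calc _ ≤ ((k + 1).choose r : ℝ) * (1 / 2 ^ (k + 1) + 1 / 2 ^ (k + 1)) := by
          gcongr
          exact (abs_sub _ _).trans (add_le_add ha hb)
      _ = _ := by simp only [Function.comp]; ring
  match i with
  | 0 => exact tendsto_const_nhds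
  | 1 =>
    have h := (tendsto_one_div_add_atTop_nhds_zero_nat (𝕜 := ℝ)).add (hterm 0)
    rw [add_zero] at h
    refine h.congr fun k => ?_
    rw [parkMatrix_row_one]
    simp
    ring
  | r + 2 =>
    refine (hterm (r + 1)).congr fun k => ?_
    rw [parkMatrix_entry, show k + (r + 1) + 1 = k + r + 2 by ring, pow_add _ (k + r) 2]
    norm_num

theorem norm_sub_comp_trunc_le (L : EllOne →L[ℝ] ℝ) {m : ℕ} {ε : ℝ} (hε : 0 ≤ ε)
    (h : ∀ j, m < j → |L (unitVec j)| ≤ ε) : ‖L - L.comp (trunc m)‖ ≤ ε := by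
  refine ContinuousLinearMap.opNorm_le_bound _ hε fun x => ?_
  have e : (L - L.comp (trunc m)) x = L (x - trunc m x) := by simp
  rw [e, ← (hasSum_functional L _).tsum_eq, ellOne_norm, ← tsum_mul_left]
  refine tsum_of_norm_bounded ((ellOne_summable x).mul_left ε).hasSum fun j => ?_
  change ‖L (unitVec j) * (x j - trunc m x j)‖ ≤ _
  rw [trunc_apply]
  split_ifs with hj
  · simp only [sub_self, mul_zero, norm_zero]
    positivity
  · rw [sub_zero, norm_mul]
    exact mul_le_mul_of_nonneg_right (h j (by omega)) (norm_nonneg _)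

theorem tendsto_norm_sub_comp_trunc {L : EllOne →L[ℝ] ℝ}
    (hL : Tendsto (fun j => L (unitVec j)) atTop (𝓝 0)) :
    Tendsto (fun m => ‖L - L.comp (trunc m)‖) atTop (𝓝 0) := by
  rw [Metric.tendsto_atTop] at hL ⊢
  intro ε hε
  obtain ⟨N, hN⟩ := hL (ε / 2) (by positivity)
  refine ⟨N, fun m hm => ?_⟩
  have h := norm_sub_comp_trunc_le L (m := m) (ε := ε / 2) (by positivity) fun j hj => by
    have := hN j (by omega)
    rw [Real.dist_eq, sub_zero] at this
    exact this.le
  rw [Real.dist_eq, sub_zero, abs_of_nonneg (norm_nonneg _)]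
  linarith

/-- The transpose preserves `c₀`: a finite part of `L` meets finitely many rows, which tend to 0,
and the remainder is small in norm against uniformly bounded columns. -/
theorem tendsto_comp_parkOp_unitVec {L : EllOne →L[ℝ] ℝ}
    (hL : Tendsto (fun j => L (unitVec j)) atTop (𝓝 0)) :
    Tendsto (fun j => L.comp parkOp (unitVec j)) atTop (𝓝 0) := by
  have htr := Metric.tendsto_atTop.1 (tendsto_norm_sub_comp_trunc hL)
  set C := max 5 (max ‖parkCol 0‖ ‖parkCol 1‖) with hC
  have hC0 : 0 < C := lt_of_lt_of_le (by norm_num) (le_max_left _ _)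
  rw [Metric.tendsto_atTop]
  intro ε hε
  obtain ⟨m, hm⟩ := htr (ε / (2 * C)) (by positivity)
  have hm := hm m le_rfl
  rw [Real.dist_eq, sub_zero, abs_of_nonneg (norm_nonneg _)] at hm
  have hfin : Tendsto (fun j => L (trunc m (parkCol j))) atTop (𝓝 0) := by
    have h : Tendsto (fun j => ∑ i ∈ Finset.range (m + 1), parkMatrix i j * L (unitVec i)) atTop
        (𝓝 (∑ i ∈ Finset.range (m + 1), 0 * L (unitVec i))) :=
      tendsto_finsetSum _ fun i _ => (tendsto_parkMatrix_row i).mul_const _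
    simp only [zero_mul, Finset.sum_const_zero] at h
    refine h.congr fun j => ?_
    rw [trunc_eq_sum, map_sum]
    refine Finset.sum_congr rfl fun i _ => ?_
    rw [single_eq_smul_unitVec, map_smul, smul_eq_mul, parkCol_apply]
  obtain ⟨N, hN⟩ := Metric.tendsto_atTop.1 hfin (ε / 2) (by positivity)
  refine ⟨N, fun j hj => ?_⟩
  have h1 := hN j hj
  rw [Real.dist_eq, sub_zero] at h1 ⊢
  have h2 : |(L - L.comp (trunc m)) (parkCol j)| ≤ ε / (2 * C) * C :=
    ((L - L.comp (trunc m)).le_opNorm _).trans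
      (mul_le_mul hm.le (parkCol_norm_le j) (norm_nonneg _) (by positivity))
  have h3 : ε / (2 * C) * C = ε / 2 := by field_simp
  have e : L.comp parkOp (unitVec j) = (L - L.comp (trunc m)) (parkCol j)
      + L (trunc m (parkCol j)) := by
    simp [parkOp_unitVec]
  rw [e]
  linarith [abs_add_le ((L - L.comp (trunc m)) (parkCol j)) (L (trunc m (parkCol j)))]

theorem tendsto_unitVec_of_limit {L : ℕ → EllOne →L[ℝ] ℝ} {L' : EllOne →L[ℝ] ℝ}
    (hL : ∀ n, Tendsto (fun j => L n (unitVec j)) atTop (𝓝 0)) (h : Tendsto L atTop (𝓝 L')) :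
    Tendsto (fun j => L' (unitVec j)) atTop (𝓝 0) := by
  rw [Metric.tendsto_atTop]
  intro ε hε
  obtain ⟨n, hn⟩ := Metric.tendsto_atTop.1 h (ε / 2) (by positivity)
  have hn := hn n le_rfl
  obtain ⟨N, hN⟩ := Metric.tendsto_atTop.1 (hL n) (ε / 2) (by positivity)
  refine ⟨N, fun j hj => ?_⟩
  have h1 := hN j hj
  rw [Real.dist_eq, sub_zero] at h1 ⊢
  rw [dist_eq_norm] at hn
  have h2 : |(L n - L') (unitVec j)| ≤ ‖L n - L'‖ := by
    simpa [norm_unitVec] using (L n - L').le_opNorm (unitVec j)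
  have e : L' (unitVec j) = L n (unitVec j) - (L n - L') (unitVec j) := by simp
  rw [e]
  linarith [abs_sub (L n (unitVec j)) ((L n - L') (unitVec j))]

theorem tendsto_left_eigen_unitVec {w : EllOne →L[ℝ] ℝ} {μ : ℝ}
    (h : Tendsto (fun n : ℕ => (μ ^ n)⁻¹ • parkFrame.φ.comp (parkOp ^ n)) atTop (𝓝 w)) :
    Tendsto (fun j => w (unitVec j)) atTop (𝓝 0) := by
  refine tendsto_unitVec_of_limit (fun n => ?_) h
  have key : Tendsto (fun j => parkFrame.φ.comp (parkOp ^ n) (unitVec j)) atTop (𝓝 0) := by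
    induction n with
    | zero =>
      refine tendsto_const_nhds.congr' ?_
      filter_upwards [eventually_gt_atTop 1] with j hj
      exact (lp.single_apply_ne (E := fun _ : ℕ => ℝ) 1 j 1 (by omega)).symm
    | succ n ih => exact tendsto_comp_parkOp_unitVec ih
  have h := key.const_mul (μ ^ n)⁻¹
  rw [mul_zero] at h
  exact h

/-- With `P` the truncation, `w (T - P T P) = μ w (1 - P) + w (1 - P) T P`, and `w (1 - P)` is small
because `w` is in `c₀`. -/
theorem tendsto_left_eigen_comp_sub {w : EllOne →L[ℝ] ℝ} {μ : ℝ}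
    (hw : ∀ x, w (parkOp x) = μ * w x) (h : Tendsto (fun j => w (unitVec j)) atTop (𝓝 0)) :
    Tendsto (fun m => ‖w.comp (parkOp - parkTrunc m)‖) atTop (𝓝 0) := by
  have h1 := (tendsto_norm_sub_comp_trunc h).const_mul (|μ| + ‖parkOp‖)
  rw [mul_zero] at h1
  refine squeeze_zero (fun _ => norm_nonneg _) (fun m => ?_) h1
  refine ContinuousLinearMap.opNorm_le_bound _ (by positivity) fun x => ?_
  have e : w.comp (parkOp - parkTrunc m) x = μ * (w - w.comp (trunc m)) x
      + (w - w.comp (trunc m)) (parkOp (trunc m x)) := by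
    simp only [ContinuousLinearMap.comp_apply, sub_apply, map_sub, parkTrunc_apply, hw]
    ring
  rw [e, add_mul, add_mul]
  refine (norm_add_le _ _).trans (add_le_add ?_ ?_)
  · rw [norm_mul, mul_assoc]
    exact mul_le_mul_of_nonneg_left (ContinuousLinearMap.le_opNorm _ _) (norm_nonneg _)
  · refine (ContinuousLinearMap.le_opNorm _ _).trans ?_
    calc _ ≤ ‖w - w.comp (trunc m)‖ * (‖parkOp‖ * ‖x‖) := by
          gcongr
          refine (parkOp.le_opNorm _).trans ?_
          gcongr
          exact norm_trunc_le m x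
      _ = _ := by ring

end Vanishing

/-! ### Strong convergence, and the entries of index 0. -/

theorem tendsto_parkTrunc (x : EllOne) : Tendsto (fun m => parkTrunc m x) atTop (𝓝 (parkOp x)) := by
  have h1 : Tendsto (fun m => parkOp (trunc m x)) atTop (𝓝 (parkOp x)) :=
    (parkOp.continuous.tendsto x).comp (tendsto_trunc x)
  have h2 : Tendsto (fun m => trunc m (parkOp (trunc m x) - parkOp x)) atTop (𝓝 0) :=
    squeeze_zero_norm (fun m => norm_trunc_le m _) (tendsto_iff_norm_sub_tendsto_zero.1 h1)
  have h3 := h2.add (tendsto_trunc (parkOp x))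
  rw [zero_add] at h3
  exact h3.congr fun m => by rw [map_sub, sub_add_cancel, parkTrunc_apply]

theorem norm_parkTrunc_le (m : ℕ) : ‖parkTrunc m‖ ≤ ‖parkOp‖ := by
  refine ContinuousLinearMap.opNorm_le_bound _ (norm_nonneg _) fun x => ?_
  rw [parkTrunc_apply]
  refine (norm_trunc_le _ _).trans ((parkOp.le_opNorm _).trans ?_)
  gcongr
  exact norm_trunc_le m x

theorem parkOp_apply_zero (x : EllOne) : parkOp x 0 = x 0 / 2 - x 1 := by
  rw [← (parkOp_hasSum x 0).tsum_eq, tsum_eq_sum (s := Finset.range 2)]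
  · simp only [Finset.sum_range_succ, Finset.sum_range_zero, parkMatrix_zero_zero,
      parkMatrix_zero_one]
    ring
  · intro j hj
    obtain ⟨n, rfl⟩ : ∃ n, j = n + 2 := ⟨j - 2, by simp at hj; omega⟩
    rw [parkMatrix_zero_add_two, zero_mul]

theorem parkTrunc_apply_zero {m : ℕ} (hm : 1 ≤ m) (x : EllOne) :
    parkTrunc m x 0 = x 0 / 2 - x 1 := by
  rw [parkTrunc_apply, trunc_apply, if_pos (by omega), parkOp_apply_zero, trunc_apply, trunc_apply,
    if_pos (by omega), if_pos hm]

theorem trunc_unitVec {m i : ℕ} (h : i ≤ m) : trunc m (unitVec i) = unitVec i := by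
  apply lp.ext
  funext j
  rw [trunc_apply]
  split_ifs with hj
  · rfl
  · exact (lp.single_apply_ne (E := fun _ : ℕ => ℝ) 1 i 1 (by omega)).symm

theorem parkCol_one : parkCol 1 = (1 / 2 + Real.log 2) • unitVec 1 - unitVec 0 := by
  apply lp.ext
  funext i
  change parkMatrix i 1 = (1 / 2 + Real.log 2) * unitVec 1 i - unitVec 0 i
  match i with
  | 0 => simp [unitVec, lp.single_apply, parkMatrix_zero_one]
  | 1 => simp [unitVec, lp.single_apply, parkMatrix_one_one]
  | r + 2 => simp [unitVec, lp.single_apply, parkMatrix_add_two_one]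

theorem parkOp_unitVec_one :
    parkOp (unitVec 1) = (1 / 2 + Real.log 2) • unitVec 1 - unitVec 0 := by
  rw [parkOp_unitVec, parkCol_one]

theorem parkTrunc_unitVec_one {m : ℕ} (hm : 1 ≤ m) :
    parkTrunc m (unitVec 1) = (1 / 2 + Real.log 2) • unitVec 1 - unitVec 0 := by
  rw [parkTrunc_apply, trunc_unitVec hm, parkOp_unitVec_one, map_sub, map_smul, trunc_unitVec hm,
    trunc_unitVec (Nat.zero_le m)]

theorem half_add_log_two_lt : 1 / 2 + Real.log 2 < parkFrame.l := by
  change 1 / 2 + Real.log 2 < 6 / 5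
  linarith [Real.log_two_lt_d9]

/-- Column 1 relates only the entries 0 and 1 of a left eigenvector. Its factor is negative once `μ
≥ l`, so positivity at index 1 passes to nonvanishing at index 0. -/
theorem left_eigen_unitVec_zero {T : EllOne →L[ℝ] EllOne} {w : EllOne →L[ℝ] ℝ} {μ : ℝ}
    (hT : T (unitVec 1) = (1 / 2 + Real.log 2) • unitVec 1 - unitVec 0)
    (hw : ∀ x, w (T x) = μ * w x) :
    w (unitVec 0) = (1 / 2 + Real.log 2 - μ) * w (unitVec 1) := by
  have h := hw (unitVec 1)
  rw [hT, map_sub, map_smul, smul_eq_mul] at h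
  linarith

theorem right_eigen_zero_neg {T : EllOne →L[ℝ] EllOne} {v : EllOne} {μ : ℝ}
    (hT : T v 0 = v 0 / 2 - v 1) (hv : v ∈ parkFrame.base) (hμ : parkFrame.l ≤ μ)
    (hTv : T v = μ • v) : v 0 < 0 := by
  rw [hTv] at hT
  have h1 : v 1 = 1 := hv.1
  have h2 : μ * v 0 = v 0 / 2 - v 1 := hT
  have h3 : (6 / 5 : ℝ) ≤ μ := hμ
  by_contra! h
  nlinarith

/-! ### Finite blocks as compressions of the operator. -/

theorem padZero_apply (p : ℝ≥0∞) {m : ℕ} (x : Fin (m + 1) → ℝ) (j : ℕ) :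
    padZero p x j = if h : j < m + 1 then x ⟨j, h⟩ else 0 := by
  rw [padZero, lp.coeFn_sum, Finset.sum_apply]
  split_ifs with h
  · rw [Finset.sum_eq_single ⟨j, h⟩]
    · exact lp.single_apply_self (E := fun _ : ℕ => ℝ) p j _
    · intro i _ hi
      exact lp.single_apply_ne (E := fun _ : ℕ => ℝ) p i _ fun hij => hi (Fin.ext hij.symm)
    · simp
  · refine Finset.sum_eq_zero fun i _ => lp.single_apply_ne (E := fun _ : ℕ => ℝ) p i _ ?_
    have := i.2
    omega

theorem padZero_fin (p : ℝ≥0∞) {m : ℕ} (x : Fin (m + 1) → ℝ) (i : Fin (m + 1)) :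
    padZero p x i = x i := by
  rw [padZero_apply, dif_pos i.2]

theorem padZero_injective (p : ℝ≥0∞) (m : ℕ) :
    Function.Injective (padZero p (m := m)) := fun x y h => by
  funext i
  rw [← padZero_fin p x, ← padZero_fin p y, h]

theorem padZero_smul {m : ℕ} (p : ℝ≥0∞) (c : ℝ) (x : Fin (m + 1) → ℝ) :
    padZero p (c • x) = c • padZero p x := by
  apply lp.ext
  funext j
  rw [lp.coeFn_smul, Pi.smul_apply, padZero_apply, padZero_apply]
  split_ifs <;> simp

theorem padZero_add {m : ℕ} (p : ℝ≥0∞) (x y : Fin (m + 1) → ℝ) :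
    padZero p (x + y) = padZero p x + padZero p y := by
  apply lp.ext
  funext j
  rw [lp.coeFn_add, Pi.add_apply, padZero_apply, padZero_apply, padZero_apply]
  split_ifs <;> simp

theorem padZero_sub {m : ℕ} (p : ℝ≥0∞) (x y : Fin (m + 1) → ℝ) :
    padZero p (x - y) = padZero p x - padZero p y := by
  apply lp.ext
  funext j
  rw [lp.coeFn_sub, Pi.sub_apply, padZero_apply, padZero_apply, padZero_apply]
  split_ifs <;> simp

theorem trunc_eq_padZero (m : ℕ) (x : EllOne) :
    trunc m x = padZero 1 fun i : Fin (m + 1) => x i := by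
  apply lp.ext
  funext j
  rw [trunc_apply, padZero_apply]
  split_ifs <;> first | rfl | omega

theorem trunc_padZero {m : ℕ} (x : Fin (m + 1) → ℝ) : trunc m (padZero 1 x) = padZero 1 x := by
  rw [trunc_eq_padZero]
  congr 1
  funext i
  exact padZero_fin 1 x i

theorem parkOp_padZero {m : ℕ} (x : Fin (m + 1) → ℝ) (i : ℕ) :
    parkOp (padZero 1 x) i = ∑ j : Fin (m + 1), parkMatrix i j * x j := by
  rw [← (parkOp_hasSum _ i).tsum_eq, tsum_eq_sum (s := Finset.range (m + 1)),
    ← Fin.sum_univ_eq_sum_range (fun j => parkMatrix i j * padZero 1 x j)]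
  · exact Finset.sum_congr rfl fun j _ => by rw [padZero_fin]
  · intro j hj
    rw [padZero_apply, dif_neg (by simpa using hj), mul_zero]

theorem parkTrunc_padZero {m : ℕ} (x : Fin (m + 1) → ℝ) :
    parkTrunc m (padZero 1 x) = padZero 1 ((parkBlock m).mulVec x) := by
  rw [parkTrunc_apply, trunc_padZero, trunc_eq_padZero]
  congr 1
  funext i
  rw [parkOp_padZero]
  rfl

/-- The functional on `ℓ¹` given by a finite row vector. -/
noncomputable def finFunctional {m : ℕ} (w : Fin (m + 1) → ℝ) : EllOne →L[ℝ] ℝ :=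
  ∑ i : Fin (m + 1), w i • lp.evalCLM ℝ (fun _ : ℕ => ℝ) 1 (i : ℕ)

theorem finFunctional_apply {m : ℕ} (w : Fin (m + 1) → ℝ) (x : EllOne) :
    finFunctional w x = w ⬝ᵥ fun i : Fin (m + 1) => x i := by
  simp only [finFunctional, sum_apply]
  rfl

theorem finFunctional_padZero {m : ℕ} (w x : Fin (m + 1) → ℝ) :
    finFunctional w (padZero 1 x) = w ⬝ᵥ x := by
  rw [finFunctional_apply]
  congr 1
  funext i
  exact padZero_fin 1 x i

theorem unitVec_eq_padZero {m : ℕ} (i : Fin (m + 1)) :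
    unitVec i = padZero 1 (Pi.single i (1 : ℝ)) := by
  rw [← trunc_unitVec (Nat.lt_succ_iff.1 i.2), trunc_eq_padZero]
  congr 1
  funext j
  rw [unitVec, lp.single_apply]
  rcases eq_or_ne j i with rfl | h
  · simp
  · rw [Pi.single_eq_of_ne h, Pi.single_eq_of_ne fun h' => h (Fin.ext h')]

theorem finFunctional_unitVec {m : ℕ} (w : Fin (m + 1) → ℝ) (i : Fin (m + 1)) :
    finFunctional w (unitVec i) = w i := by
  rw [unitVec_eq_padZero, finFunctional_padZero, dotProduct_single, mul_one]

theorem finFunctional_injective (m : ℕ) : Function.Injective (finFunctional (m := m)) := by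
  intro x y h
  funext i
  rw [← finFunctional_unitVec x, ← finFunctional_unitVec y, h]

theorem dualSeq_finFunctional {m : ℕ} (w : Fin (m + 1) → ℝ) :
    dualSeq (finFunctional w) = padZero ∞ w := by
  apply lp.ext
  funext j
  rw [dualSeq_apply, padZero_apply]
  split_ifs with h
  · exact finFunctional_unitVec w ⟨j, h⟩
  · rw [finFunctional_apply]
    refine Finset.sum_eq_zero fun i _ => ?_
    have hi := i.2
    have h0 : unitVec j i = 0 :=
      lp.single_apply_ne (E := fun _ : ℕ => ℝ) 1 j 1 (by omega)
    exact mul_eq_zero_of_right _ h0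

theorem finFunctional_parkTrunc {m : ℕ} (w : Fin (m + 1) → ℝ) (x : EllOne) :
    finFunctional w (parkTrunc m x) = finFunctional (Matrix.vecMul w (parkBlock m)) x := by
  have h : parkTrunc m x = padZero 1 ((parkBlock m).mulVec fun i : Fin (m + 1) => x i) := by
    rw [← parkTrunc_padZero, ← trunc_eq_padZero, parkTrunc_apply, parkTrunc_apply,
      trunc_eq_padZero m (trunc m x), trunc_eq_padZero m x]
    congr 3
    funext i
    rw [padZero_fin]
  rw [h, finFunctional_padZero, finFunctional_apply, Matrix.dotProduct_mulVec]

theorem finFunctional_smul {m : ℕ} (c : ℝ) (w : Fin (m + 1) → ℝ) :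
    finFunctional (c • w) = c • finFunctional w := by
  ext x
  rw [smul_apply, finFunctional_apply, finFunctional_apply, smul_dotProduct]

theorem right_eigen_iff {m : ℕ} {x : Fin (m + 1) → ℝ} {μ : ℝ} :
    (parkBlock m).mulVec x = μ • x ↔ parkTrunc m (padZero 1 x) = μ • padZero 1 x := by
  rw [parkTrunc_padZero, ← padZero_smul]
  exact (padZero_injective 1 m).eq_iff.symm

theorem left_eigen_iff {m : ℕ} {w : Fin (m + 1) → ℝ} {μ : ℝ} :
    Matrix.vecMul w (parkBlock m) = μ • w ↔
      ∀ x, finFunctional w (parkTrunc m x) = μ * finFunctional w x := by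
  rw [← (finFunctional_injective m).eq_iff, ContinuousLinearMap.ext_iff, finFunctional_smul]
  refine forall_congr' fun x => ?_
  rw [finFunctional_parkTrunc]
  rfl

theorem Matrix.mem_spectrum_iff_exists_mulVec {n K : Type*} [Fintype n] [DecidableEq n] [Field K]
    {M : Matrix n n K} {z : K} : z ∈ spectrum K M ↔ ∃ x ≠ 0, M.mulVec x = z • x := by
  rw [spectrum.mem_iff, Matrix.isUnit_iff_isUnit_det, isUnit_iff_ne_zero, not_not,
    ← Matrix.exists_mulVec_eq_zero_iff]
  refine exists_congr fun x => and_congr_right fun _ => ?_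
  rw [Matrix.sub_mulVec, Algebra.algebraMap_eq_smul_one, Matrix.smul_mulVec, Matrix.one_mulVec,
    sub_eq_zero, eq_comm]

theorem norm_le_of_mem_spectrum {m : ℕ} (hm : 4 ≤ m) {v : EllOne} {μ : ℝ}
    (hv : v ∈ parkFrame.base) (hTv : parkTrunc m v = μ • v) {z : ℂ}
    (hz : z ∈ spectrum ℂ ((parkBlock m).map (algebraMap ℝ ℂ))) (hzμ : z ≠ μ) :
    ‖z‖ ≤ parkFrame.q := by
  obtain ⟨x, hx0, hx⟩ := Matrix.mem_spectrum_iff_exists_mulVec.1 hz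
  have hre : ∀ i, (((parkBlock m).map (algebraMap ℝ ℂ)).mulVec x i).re =
      (parkBlock m).mulVec (fun j => (x j).re) i := by
    intro i
    simp [Matrix.mulVec, dotProduct, Complex.re_sum]
  have him : ∀ i, (((parkBlock m).map (algebraMap ℝ ℂ)).mulVec x i).im =
      (parkBlock m).mulVec (fun j => (x j).im) i := by
    intro i
    simp [Matrix.mulVec, dotProduct, Complex.im_sum]
  refine (parkFrame_contracts_parkTrunc hm).norm_le_of_complex_eigen hv hTv
    (a := padZero 1 fun j => (x j).re) (b := padZero 1 fun j => (x j).im) ?_ ?_ ?_ hzμ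
  · by_contra! h
    apply hx0
    funext j
    have h1 := padZero_fin 1 (fun j => (x j).re) j
    have h2 := padZero_fin 1 (fun j => (x j).im) j
    rw [h.1] at h1
    rw [h.2] at h2
    exact Complex.ext h1.symm h2.symm
  · rw [parkTrunc_padZero, ← padZero_smul, ← padZero_smul, ← padZero_sub]
    congr 1
    funext i
    rw [← hre, hx]
    simp
  · rw [parkTrunc_padZero, ← padZero_smul, ← padZero_smul, ← padZero_add]
    congr 1
    funext i
    rw [← him, hx]
    simp
    ring

/-- Translates between the normalization of the cone and that at index 0. An eigenvalue other than
`μ` has modulus at most `q < μ`, so it cannot dominate. -/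
theorem isPrincipalTriple_iff {m : ℕ} (hm : 4 ≤ m) {v : EllOne} {μ : ℝ} {w : EllOne →L[ℝ] ℝ}
    (hv : v ∈ parkFrame.base) (hμ : parkFrame.l ≤ μ) (hTv : parkTrunc m v = μ • v)
    (hw : ∀ x, w (parkTrunc m x) = μ * w x) (hwe : 0 < w (unitVec 1))
    (hlim : ∀ x, Tendsto (fun n : ℕ => (μ ^ n)⁻¹ • (parkTrunc m ^ n) x) atTop (𝓝 (w x • v)))
    {μ' : ℝ} {v' w' : Fin (m + 1) → ℝ} :
    IsPrincipalTriple m μ' v' w' ↔ μ' = μ ∧ padZero 1 v' = (v 0)⁻¹ • v ∧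
      finFunctional w' = (w (unitVec 0))⁻¹ • w := by
  have hT := parkFrame_contracts_parkTrunc hm
  have hμ0 : 0 < μ := parkFrame.l_pos.trans_le hμ
  have hqμ : parkFrame.q < μ := parkFrame.q_lt_l.trans_le hμ
  have hv0 : v 0 < 0 := right_eigen_zero_neg (parkTrunc_apply_zero (by omega) v) hv hμ hTv
  have hw0 : w (unitVec 0) ≠ 0 := by
    rw [left_eigen_unitVec_zero (parkTrunc_unitVec_one (by omega)) hw]
    exact mul_ne_zero (by linarith [half_add_log_two_lt]) hwe.ne'
  constructor
  · intro h
    have hv' := right_eigen_iff.1 h.right_eigen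
    have hv'0 : padZero 1 v' 0 = 1 := by
      rw [← h.right_zero]; exact padZero_fin 1 v' 0
    have hμ' : μ' = μ := by
      by_contra hne
      have h1 : ‖(μ' : ℂ)‖ ≤ parkFrame.q := by
        refine hT.norm_le_of_complex_eigen hv hTv (a := padZero 1 v') (b := 0) (Or.inl ?_) ?_ ?_ ?_
        · intro h0
          rw [h0] at hv'0
          exact zero_ne_one hv'0
        · simpa using hv'
        · simp
        · exact_mod_cast hne
      have h2 : (μ : ℂ) ∈ spectrum ℂ ((parkBlock m).map (algebraMap ℝ ℂ)) := by
        rw [Matrix.mem_spectrum_iff_exists_mulVec]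
        -- Since `μ ≠ 0`, the eigenvector lies in the range of the compression and is supported on
        -- `0, …, m`.
        have hvt : padZero 1 (fun i : Fin (m + 1) => v i) = v := by
          rw [← trunc_eq_padZero]
          have h3 : v = μ⁻¹ • parkTrunc m v := by
            rw [hTv, smul_smul, inv_mul_cancel₀ hμ0.ne', one_smul]
          rw [h3, map_smul, parkTrunc_apply, trunc_eq_padZero m (parkOp _), trunc_padZero]
        have h4 : (parkBlock m).mulVec (fun i : Fin (m + 1) => v i)
            = μ • fun i : Fin (m + 1) => v i := by
          rw [right_eigen_iff, hvt, hTv]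
        refine ⟨fun i => ((v i : ℝ) : ℂ), fun h0 => ?_, ?_⟩
        · have := congrFun h0 0
          simp only [Pi.zero_apply, Complex.ofReal_eq_zero] at this
          exact hv0.ne this
        · funext i
          have h5 := congrArg (fun t : ℝ => (t : ℂ)) (congrFun h4 i)
          simpa [Matrix.mulVec, dotProduct] using h5
      have h3 := h.dominant μ h2 (by exact_mod_cast Ne.symm hne)
      rw [Complex.norm_real, Real.norm_eq_abs] at h1 h3
      linarith [le_abs_self μ]
    subst hμ'
    refine ⟨rfl, ?_, ?_⟩
    · have h1 := hT.right_eigen_unique hv hTv hμ hv'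
      have h2 : (1 : ℝ) = parkFrame.φ (padZero 1 v') * v 0 := by
        rw [← hv'0, h1, lp.coeFn_smul, Pi.smul_apply, smul_eq_mul, map_smul, hv.1, smul_eq_mul,
          mul_one]
      rw [h1, eq_inv_of_mul_eq_one_left h2.symm]
    · have hw' := left_eigen_iff.1 h.left_eigen
      have h1 := fun x => ConeFrame.Contracts.left_eigen_unique hlim hμ0 hw' x
      have h2 : finFunctional w' (unitVec 0) = 1 := by
        rw [← h.left_zero]; exact finFunctional_unitVec w' 0
      rw [h1] at h2
      ext x
      rw [h1, smul_apply, smul_eq_mul, ← eq_inv_of_mul_eq_one_right h2, mul_comm]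
  · rintro ⟨rfl, h1, h2⟩
    refine ⟨?_, ?_, ?_, ?_, fun z hz hzμ => ?_⟩
    · rw [right_eigen_iff, h1, map_smul, hTv, smul_comm]
    · rw [left_eigen_iff, h2]
      intro x
      rw [smul_apply, smul_apply, hw, smul_eq_mul, smul_eq_mul]
      ring
    · rw [← padZero_fin 1 v' 0, h1]
      exact inv_mul_cancel₀ hv0.ne
    · rw [← finFunctional_unitVec w' 0, h2]
      exact inv_mul_cancel₀ hw0
    · rw [abs_of_pos hμ0]
      exact (norm_le_of_mem_spectrum hm hv hTv hz hzμ).trans_lt hqμ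

theorem existsUnique_isPrincipalTriple {m : ℕ} (hm : 4 ≤ m) :
    ∃! t : ℝ × (Fin (m + 1) → ℝ) × (Fin (m + 1) → ℝ), IsPrincipalTriple m t.1 t.2.1 t.2.2 := by
  obtain ⟨v, μ, w, hv, hμ, hTv, hw, -, hwe, -, hlim⟩ :=
    (parkFrame_contracts_parkTrunc hm).exists_principal
  have iff := fun {μ'} {v' w'} =>
    isPrincipalTriple_iff hm hv hμ hTv hw hwe hlim (μ' := μ') (v' := v') (w' := w')
  have hμ0 : 0 < μ := parkFrame.l_pos.trans_le hμ
  have hrange : ∀ x, parkTrunc m x = trunc m (parkTrunc m x) := fun x => by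
    rw [parkTrunc_apply, trunc_eq_padZero m (parkOp _), trunc_padZero]
  have hv' : padZero 1 (fun i : Fin (m + 1) => ((v 0)⁻¹ • v) i) = (v 0)⁻¹ • v := by
    have h3 : v = μ⁻¹ • parkTrunc m v := by
      rw [hTv, smul_smul, inv_mul_cancel₀ hμ0.ne', one_smul]
    rw [← trunc_eq_padZero, map_smul]
    congr 1
    conv_rhs => rw [h3, hrange, ← map_smul, ← h3]
  have hw' : finFunctional (fun i : Fin (m + 1) => ((w (unitVec 0))⁻¹ • w) (unitVec i))
      = (w (unitVec 0))⁻¹ • w := by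
    set c := (w (unitVec 0))⁻¹ • w with hc
    have hcT : ∀ x, c x = μ⁻¹ * c (parkTrunc m x) := fun x => by
      rw [hc, smul_apply, smul_apply, hw, smul_eq_mul, smul_eq_mul]
      field_simp
    -- Dually, a left eigenvector factors through truncation, hence comes from a finite row.
    have htr : ∀ x, c x = c (trunc m x) := fun x => by
      rw [hcT, hcT (trunc m x), parkTrunc_apply, parkTrunc_apply, trunc_eq_padZero m x,
        trunc_padZero]
    ext x
    rw [htr x, trunc_eq_sum, map_sum, finFunctional_apply,
      ← Fin.sum_univ_eq_sum_range (fun i => c (lp.single 1 i (x i)))]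
    refine Finset.sum_congr rfl fun i _ => ?_
    rw [single_eq_smul_unitVec, map_smul, smul_eq_mul, mul_comm]
  refine ⟨(μ, fun i => ((v 0)⁻¹ • v) i, fun i => ((w (unitVec 0))⁻¹ • w) (unitVec i)),
    iff.2 ⟨rfl, hv', hw'⟩, ?_⟩
  rintro ⟨μ', x, y⟩ h
  obtain ⟨h1, h2, h3⟩ := iff.1 h
  exact Prod.ext h1 (Prod.ext (padZero_injective 1 m (h2.trans hv'.symm))
    (finFunctional_injective m (h3.trans hw'.symm)))

theorem norm_le_of_isComplexEigen {v : EllOne} {μ : ℝ} (hv : v ∈ parkFrame.base)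
    (hTv : parkOp v = μ • v) {z : ℂ} {x : ℕ → ℂ} (hx : IsComplexEigen z x) (hz : z ≠ μ) :
    ‖z‖ ≤ parkFrame.q := by
  obtain ⟨hx0, hs, hsum⟩ := hx
  have mem : ∀ f : ℕ → ℝ, (∀ j, |f j| ≤ ‖x j‖) → Memℓp f 1 := fun f hf =>
    (memℓp_gen_iff (p := 1) (by simp)).2 (by
      simpa using Summable.of_nonneg_of_le (fun _ => abs_nonneg _) hf hs)
  set a : EllOne := ⟨fun j => (x j).re, mem _ fun j => Complex.abs_re_le_norm _⟩ with ha
  set b : EllOne := ⟨fun j => (x j).im, mem _ fun j => Complex.abs_im_le_norm _⟩ with hb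
  refine parkFrame_contracts_parkOp.norm_le_of_complex_eigen hv hTv (a := a) (b := b) ?_ ?_ ?_ hz
  · by_contra! h
    apply hx0
    funext j
    have h1 : a j = 0 := by rw [h.1]; rfl
    have h2 : b j = 0 := by rw [h.2]; rfl
    exact Complex.ext h1 h2
  · apply lp.ext
    funext i
    have h := (hsum i).mapL Complex.reCLM
    have e : (fun j => parkMatrix i j * a j) =
        fun j => Complex.reCLM ((parkMatrix i j : ℂ) * x j) := by
      funext j
      simp [ha]
    rw [← e] at h
    rw [(parkOp_hasSum a i).unique h]
    change (z * x i).re = z.re * (x i).re - z.im * (x i).im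
    rw [Complex.mul_re]
  · apply lp.ext
    funext i
    have h := (hsum i).mapL Complex.imCLM
    have e : (fun j => parkMatrix i j * b j) =
        fun j => Complex.imCLM ((parkMatrix i j : ℂ) * x j) := by
      funext j
      simp [hb]
    rw [← e] at h
    rw [(parkOp_hasSum b i).unique h]
    change (z * x i).im = z.im * (x i).re + z.re * (x i).im
    rw [Complex.mul_im]
    ring

/-- Normalization ignores positive factors and is continuous away from 0. -/
theorem tendsto_normalize_of_tendsto {E : Type*} [NormedAddCommGroup E] [NormedSpace ℝ E]
    {x : ℕ → E} {c : ℕ → ℝ} {y : E} {t : ℝ} (hc : ∀ n, 0 < c n) (ht : 0 < t) (hy : y ≠ 0)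
    (h : Tendsto (fun n => c n • x n) atTop (𝓝 (t • y))) :
    Tendsto (fun n => ‖x n‖⁻¹ • x n) atTop (𝓝 (‖y‖⁻¹ • y)) := by
  have scale : ∀ {s : ℝ} {z : E}, 0 < s → ‖s • z‖⁻¹ • s • z = ‖z‖⁻¹ • z := by
    intro s z hs
    rw [norm_smul, Real.norm_eq_abs, abs_of_pos hs, smul_smul, mul_inv]
    congr 1
    field_simp
  have hne : ‖t • y‖ ≠ 0 := norm_ne_zero_iff.2 (smul_ne_zero ht.ne' hy)
  have h' := (h.norm.inv₀ hne).smul h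
  rw [scale ht] at h'
  exact h'.congr fun n => scale (hc n)

theorem mainTheorem4 :
    -- the truncations have well-defined principal eigenvalues and eigenvectors
    (∀ m : ℕ, 7 ≤ m →
      ∃! t : ℝ × (Fin (m + 1) → ℝ) × (Fin (m + 1) → ℝ),
        IsPrincipalTriple m t.1 t.2.1 t.2.2) ∧
    ∀ (lamSeq : ℕ → ℝ) (vSeq wSeq : (m : ℕ) → Fin (m + 1) → ℝ),
      (∀ m : ℕ, 7 ≤ m → IsPrincipalTriple m (lamSeq m) (vSeq m) (wSeq m)) →
      ∃ (lam : ℝ) (v : EllOne) (w : EllInf),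
        -- `lam`, `v`, `w` are the limits
        Tendsto lamSeq atTop (𝓝 lam) ∧
        Tendsto (fun m => padZero 1 (vSeq m)) atTop (𝓝 v) ∧
        Tendsto (fun m => padZero ∞ (wSeq m)) atTop (𝓝 w) ∧
        -- `lam` is the dominant eigenvalue of the operator, with eigenvectors `v` and `w`
        0 < lam ∧
        parkOp v = lam • v ∧
        (∀ j : ℕ, HasSum (fun i => w i * parkMatrix i j) (lam * w j)) ∧
        (∀ (z : ℂ) (x : ℕ → ℂ), IsComplexEigen z x → z ≠ (lam : ℂ) → ‖z‖ < lam) ∧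
        rowMul w v ≠ 0 ∧
        -- convergence of the iterates in `ℓ¹`
        ∀ u : EllOne, rowMul w u ≠ 0 →
          Tendsto (fun n : ℕ => (lam ^ n)⁻¹ • (parkOp ^ n) u) atTop
            (𝓝 ((rowMul w u / rowMul w v) • v)) ∧
          Tendsto (fun n : ℕ => ‖(parkOp ^ n) u‖⁻¹ • (parkOp ^ n) u) atTop
            (𝓝 (‖rowMul w u • v‖⁻¹ • (rowMul w u • v))) := by
  refine ⟨fun m hm => existsUnique_isPrincipalTriple (by omega), fun lamSeq vSeq wSeq hseq => ?_⟩
  have hTm : ∀ m, 7 ≤ m → parkFrame.Contracts (parkTrunc m) := fun m hm =>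
    parkFrame_contracts_parkTrunc (by omega)
  have hdata : ∀ m, ∃ (v : EllOne) (μ : ℝ) (w : EllOne →L[ℝ] ℝ), 7 ≤ m →
      v ∈ parkFrame.base ∧ parkFrame.l ≤ μ ∧ parkTrunc m v = μ • v ∧
      (∀ x, w (parkTrunc m x) = μ * w x) ∧ 0 < w (unitVec 1) ∧
      lamSeq m = μ ∧ padZero 1 (vSeq m) = (v 0)⁻¹ • v ∧
      finFunctional (wSeq m) = (w (unitVec 0))⁻¹ • w := by
    intro m
    by_cases hm : 7 ≤ m
    · obtain ⟨v, μ, w, hv, hμ, hTv, hw, -, hwe, -, hlim⟩ := (hTm m hm).exists_principal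
      exact ⟨v, μ, w, fun _ => ⟨hv, hμ, hTv, hw, hwe,
        (isPrincipalTriple_iff (by omega) hv hμ hTv hw hwe hlim).1 (hseq m hm)⟩⟩
    · exact ⟨0, 0, 0, fun h => absurd h hm⟩
  choose vm μm wm hm using hdata
  obtain ⟨v, μ, w, hv, hμ, hTv, hw, hwv, hwe, hwlim, hlim⟩ :=
    parkFrame_contracts_parkOp.exists_principal
  change 0 < w (unitVec 1) at hwe
  have hμ0 : 0 < μ := parkFrame.l_pos.trans_le hμ
  have hqμ : parkFrame.q < μ := parkFrame.q_lt_l.trans_le hμ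
  have hvlim : Tendsto vm atTop (𝓝 v) :=
    ConeFrame.tendsto_right_eigen parkFrame_contracts_parkOp hTm tendsto_parkTrunc hv hTv hμ
      (fun m h => (hm m h).1) (fun m h => (hm m h).2.2.1) (fun m h => (hm m h).2.1)
  have hμlim : Tendsto μm atTop (𝓝 μ) :=
    ConeFrame.tendsto_eigenvalue hv hTv tendsto_parkTrunc norm_parkTrunc_le
      (fun m h => (hm m h).1) (fun m h => (hm m h).2.2.1) hvlim
  -- Left eigenvectors are compared with value 1 at `e`, where their difference must vanish.
  have hwmlim : Tendsto (fun m => (wm m (unitVec 1))⁻¹ • wm m) atTop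
      (𝓝 ((w (unitVec 1))⁻¹ • w)) := by
    have hw1 : ∀ x, ((w (unitVec 1))⁻¹ • w) (parkOp x) = μ * ((w (unitVec 1))⁻¹ • w) x := by
      intro x
      rw [smul_apply, smul_apply, hw, smul_eq_mul, smul_eq_mul]
      ring
    refine ConeFrame.tendsto_left_eigen hTm (fun m h => (hm m h).2.1) hμlim hw1 ?_ ?_ ?_ ?_
    · exact inv_mul_cancel₀ hwe.ne'
    · intro m h x
      rw [smul_apply, smul_apply, (hm m h).2.2.2.1, smul_eq_mul, smul_eq_mul]
      ring
    · intro m h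
      exact inv_mul_cancel₀ (hm m h).2.2.2.2.1.ne'
    · refine tendsto_left_eigen_comp_sub hw1 ?_
      have h := (tendsto_left_eigen_unitVec hwlim).const_mul (w (unitVec 1))⁻¹
      rw [mul_zero] at h
      exact h
  have hv0 : v 0 < 0 := right_eigen_zero_neg (parkOp_apply_zero v) hv hμ hTv
  have hw0 := left_eigen_unitVec_zero parkOp_unitVec_one hw
  have hα : 1 / 2 + Real.log 2 - μ < 0 := by linarith [half_add_log_two_lt]
  have hw0neg : w (unitVec 0) < 0 := by rw [hw0]; exact mul_neg_of_neg_of_pos hα hwe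
  have hζ : rowMul (dualSeq ((w (unitVec 0))⁻¹ • w)) ((v 0)⁻¹ • v)
      = (w (unitVec 0))⁻¹ * (v 0)⁻¹ := by
    rw [rowMul_dualSeq, smul_apply, map_smul, hwv, smul_eq_mul, smul_eq_mul, mul_one]
  have hζpos : 0 < (w (unitVec 0))⁻¹ * (v 0)⁻¹ :=
    mul_pos_of_neg_of_neg (inv_lt_zero.2 hw0neg) (inv_lt_zero.2 hv0)
  refine ⟨μ, (v 0)⁻¹ • v, dualSeq ((w (unitVec 0))⁻¹ • w), ?_, ?_, ?_, hμ0, ?_, ?_, ?_, ?_, ?_⟩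
  · refine hμlim.congr' ?_
    filter_upwards [eventually_ge_atTop 7] with m h
    exact (hm m h).2.2.2.2.2.1.symm
  · have h0 : Tendsto (fun m => vm m 0) atTop (𝓝 (v 0)) :=
      ((lp.evalCLM ℝ (fun _ : ℕ => ℝ) 1 0).continuous.tendsto v).comp hvlim
    refine ((h0.inv₀ hv0.ne).smul hvlim).congr' ?_
    filter_upwards [eventually_ge_atTop 7] with m h
    exact (hm m h).2.2.2.2.2.2.1.symm
  · have h1 : Tendsto (fun m => (1 / 2 + Real.log 2 - μm m)⁻¹ • (wm m (unitVec 1))⁻¹ • wm m) atTop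
        (𝓝 ((1 / 2 + Real.log 2 - μ)⁻¹ • (w (unitVec 1))⁻¹ • w)) :=
      ((hμlim.const_sub _).inv₀ hα.ne).smul hwmlim
    rw [smul_smul, ← mul_inv, ← hw0] at h1
    refine ((dualSeq.continuous.tendsto _).comp h1).congr' ?_
    filter_upwards [eventually_ge_atTop 7] with m h
    obtain ⟨-, -, -, hwm, -, -, -, hf⟩ := hm m h
    rw [Function.comp, ← dualSeq_finFunctional, hf,
      left_eigen_unitVec_zero (parkTrunc_unitVec_one (by omega)) hwm, smul_smul, mul_inv]
  · rw [map_smul, hTv, smul_comm]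
  · intro j
    have h := hasSum_functional ((w (unitVec 0))⁻¹ • w) (parkCol j)
    have e : ((w (unitVec 0))⁻¹ • w) (parkCol j) = μ * dualSeq ((w (unitVec 0))⁻¹ • w) j := by
      rw [dualSeq_apply, ← parkOp_unitVec, smul_apply, smul_apply, hw, smul_eq_mul, smul_eq_mul]
      ring
    rw [e] at h
    exact h
  · intro z x hx hz
    exact (norm_le_of_isComplexEigen hv hTv hx hz).trans_lt hqμ
  · rw [hζ]
    exact hζpos.ne'
  · intro u hu
    have hlimu : Tendsto (fun n : ℕ => (μ ^ n)⁻¹ • (parkOp ^ n) u) atTop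
        (𝓝 ((rowMul (dualSeq ((w (unitVec 0))⁻¹ • w)) u
          / rowMul (dualSeq ((w (unitVec 0))⁻¹ • w)) ((v 0)⁻¹ • v)) • (v 0)⁻¹ • v)) := by
      have h := hlim u
      have e : (rowMul (dualSeq ((w (unitVec 0))⁻¹ • w)) u
          / rowMul (dualSeq ((w (unitVec 0))⁻¹ • w)) ((v 0)⁻¹ • v)) • (v 0)⁻¹ • v = w u • v := by
        rw [hζ, rowMul_dualSeq, smul_apply, smul_eq_mul, smul_smul]
        congr 1
        have := hw0neg.ne
        have := hv0.ne
        field_simp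
      rw [e]
      exact h
    refine ⟨hlimu, ?_⟩
    -- Here `ζ > 0`, as both entries of index 0 are negative, so dividing by it preserves the
    -- direction of `(w u) v`.
    refine tendsto_normalize_of_tendsto (c := fun n => (μ ^ n)⁻¹)
      (t := (rowMul (dualSeq ((w (unitVec 0))⁻¹ • w)) ((v 0)⁻¹ • v))⁻¹)
      (fun n => by positivity) (by rw [hζ]; exact inv_pos.2 hζpos) ?_ ?_
    · refine smul_ne_zero hu (smul_ne_zero (inv_ne_zero hv0.ne) fun h => ?_)
      rw [h, map_zero] at hwv
      exact zero_ne_one hwv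
    · rw [smul_smul, inv_mul_eq_div]
      exact hlimu
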